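/- Let $C$ be a finite set of candidates with $|C|\ge 3$, let $N=\{1,\dots,n\}$, $n\ge 1$, be a set of voters, and let $P$ be a preference profile, i.e. a strict total order $\succ_i$ on $C$ for each $i\in N$. For $S\subseteq C$ let $\mathrm{top}(i,S)$, $\mathrm{second}(i,S)$ and $\mathrm{bottom}(i,S)$ be the most, second most and least preferred candidate of voter $i$ in $S$. $P$ is single-peaked on a tree $T$ with vertex set $C$ if $\mathrm{top}(i,C)\succ_i b\succ_i a$ for every $i\in N$, every $a\in C$ and every vertex $b\ne a,\mathrm{top}(i,C)$ on the path in $T$ from $\mathrm{top}(i,C)$ to $a$. Let $\mathcal T(P)$ be the set of all such trees, and assume $\mathcal T(P)\neq\emptyset$. Leaves are vertices of degree $1$; all other vertices are internal. An attachment digraph $D=(C,A)$ of $P$ is built as follows. Start with $S=C$ and $A=\emptyset$. While $|S|\ge 3$, let $L=\{\mathrm{bottom}(i,S): i\in N\}$; for each $a\in L$ let $B(a)=\bigcap_{i\in N}B(i,S,a)$, where $B(i,S,a)=\{\mathrm{second}(i,S)\}$ if $\mathrm{top}(i,S)=a$ and $B(i,S,a)=\{c\in S: c\succ_i a\}$ otherwise;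 fail if $B(a)=\emptyset$, else add the arcs $(a,b)$, $b\in B(a)$, to $A$; then replace $S$ by $S\setminus L$. If $|S|=2$ at the end, add one arc between the two remaining candidates, arbitrarily directed. The algorithm MinLeaves is the following. Compute an attachment digraph $D$; let $t$ be its sink and choose a vertex $s$ whose only outgoing arc is $(s,t)$; put $f(s)=t$. Let $H$ be the bipartite graph with vertices $\ell_a$ ($a\in C\setminus\{s,t\}$) and $r_c$ ($c\in C$), and with edges $\{\ell_a,r_c\}$ for $(a,c)\in A$, $a \neq s$. Find a maximum matching $M$ of $H$. For each $a\in C\setminus\{s,t\}$, let $f(a)=c$ if $\{\ell_a,r_c\}\in M$, and let $f(a)$ be an arbitrary $c$ with $(a,c)\in A$ if $\ell_a$ is unmatched. Return the graph $T(f)$ on $C$ with edges $\{a,f(a)\}$, $a\in C\setminus\{t\}$. Proposition. (i) The construction of $D$ succeeds, all choices that the algorithm has to make are possible, and, whatever choices are made, the returned graph $T^*=T(f)$ is a tree in $\mathcal T(P)$ that has the minimum number of leaves among all trees in $\mathcal T(P)$, and the number of internal vertices of $T^*$ equals $|M|$. (ii) The algorithm can be carried out in polynomial time: there are a single program for a random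 access machine (unit-cost assignments, tests, array accesses, additions and subtractions on natural numbers, no multiplication) and a polynomial $q$ such that for every profile $P$ as above with $m$ candidates and $n$ voters, given by the table of the positions $\mathrm{pos}(i,a)=|\{b: b\succ_i a\}|+1$, the program halts after at most $q(mn)$ steps and outputs the objects $D,s,t,M,f,T(f)$ of a run of the algorithm. -/

import Mathlib

universe u v

/-! ## Preference profiles and single-peakedness on trees -/

/-- A preference profile: every voter `i : N` has a strict total order on the candidates `C`;
`prefers i a b` means that voter `i` prefers `a` to `b`. -/
structure Profile (C : Type u) (N : Type v) where
  prefers : N → C → C → Prop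
  isStrictTotalOrder : ∀ i, IsStrictTotalOrder C (prefers i)

namespace Profile

/-- The position of candidate `a` in the order of voter `i`; the favourite has position `1`. -/
noncomputable def pos {C : Type u} {N : Type v} (P : Profile C N) (i : N) (a : C) : ℕ :=
  {b : C | P.prefers i b a}.ncard + 1

/-- `a = top(i, S)`: `a` is the most preferred candidate of voter `i` within `S`. -/
def IsTop {C : Type u} {N : Type v} (P : Profile C N) (i : N) (S : Set C) (a : C) : Prop :=
  a ∈ S ∧ ∀ b ∈ S, b ≠ a → P.prefers i a b

/-- `b = second(i, S)`: `b` is the second most preferred candidate of voter `i` within `S`. -/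
def IsSecond {C : Type u} {N : Type v} (P : Profile C N) (i : N) (S : Set C) (b : C) : Prop :=
  ∃ a, P.IsTop i S a ∧ P.IsTop i (S \ {a}) b

/-- `a = bottom(i, S)`: `a` is the least preferred candidate of voter `i` within `S`. -/
def IsBottom {C : Type u} {N : Type v} (P : Profile C N) (i : N) (S : Set C) (a : C) : Prop :=
  a ∈ S ∧ ∀ b ∈ S, b ≠ a → P.prefers i b a

/-- `P` is single-peaked on the tree `T`: whenever `b` lies on the path in `T` from the favourite
`t` of voter `i` to `a` (and is different from both ends), voter `i` ranks `t` above `b` and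
`b` above `a`. -/
def SinglePeakedOn {C : Type u} {N : Type v} (P : Profile C N) (T : SimpleGraph C) : Prop :=
  ∀ (i : N) (t a b : C), P.IsTop i Set.univ t → a ≠ b → b ≠ t →
    ∀ p : T.Walk t a, p.IsPath → b ∈ p.support → P.prefers i t b ∧ P.prefers i b a

/-- The set `𝒯(P)` of all trees with vertex set `C` on which `P` is single-peaked. -/
def trees {C : Type u} {N : Type v} (P : Profile C N) : Set (SimpleGraph C) :=
  {T | T.IsTree ∧ P.SinglePeakedOn T}

/-! ## The attachment digraph -/

/-- `L(S) = {bottom(i, S) : i ∈ N}`. -/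
def bottoms {C : Type u} {N : Type v} (P : Profile C N) (S : Set C) : Set C :=
  {a | ∃ i, P.IsBottom i S a}

/-- `B(i, S, a)`: the candidates of `S` that voter `i` prefers to `a` if `top(i, S) ≠ a`, and
`{second(i, S)}` if `top(i, S) = a`. -/
def attachableFor {C : Type u} {N : Type v} (P : Profile C N) (i : N) (S : Set C) (a : C) :
    Set C :=
  {c | (¬ P.IsTop i S a ∧ c ∈ S ∧ P.prefers i c a) ∨ (P.IsTop i S a ∧ P.IsSecond i S c)}

/-- `B(S, a) = ⋂_{i ∈ N} B(i, S, a)`. -/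
def attachable {C : Type u} {N : Type v} (P : Profile C N) (S : Set C) (a : C) : Set C :=
  ⋂ i : N, P.attachableFor i S a

/-- `P.Builds S D`: the procedure that builds the attachment digraph, started on the set `S` of
remaining candidates, can succeed and add exactly the arcs of `D`. While at least three candidates
remain, all arcs `(a, b)` with `a` ranked last among them by some voter and `b ∈ B(S, a)` are
added (the procedure fails if such an `a` has `B(S, a) = ∅`), and these `a` are removed. If two
candidates remain in the end, one arc between them is added, arbitrarily directed. -/
inductive Builds {C : Type u} {N : Type v} (P : Profile C N) : Set C → Digraph C → Prop
  | small (S : Set C) (hS : S.Subsingleton) : Builds P S { Adj := fun _ _ => False }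
  | pair (a b : C) (hab : a ≠ b) : Builds P {a, b} { Adj := fun x y => x = a ∧ y = b }
  | round (S : Set C) (D : Digraph C) (hS : 3 ≤ S.ncard)
      (hB : ∀ a ∈ P.bottoms S, (P.attachable S a).Nonempty)
      (hD : Builds P (S \ P.bottoms S) D) :
      Builds P S { Adj := fun x y => (x ∈ P.bottoms S ∧ y ∈ P.attachable S x) ∨ D.Adj x y }

/-- `D` is an attachment digraph of `P` (it is unique up to the direction of one arc). -/
def IsAttachmentDigraph {C : Type u} {N : Type v} (P : Profile C N) (D : Digraph C) : Prop :=
  P.Builds Set.univ D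

end Profile

/-! ## Attachment functions and leaves -/

/-- The graph `T(f)` on `C` with edge set `{{a, f(a)} : a ≠ t}`. -/
def attachmentTree {C : Type u} {t : C} (f : {a : C // a ≠ t} → C) : SimpleGraph C :=
  SimpleGraph.fromEdgeSet {e | ∃ a : {a : C // a ≠ t}, e = s(a.1, f a)}

/-- The leaves of a graph: the vertices of degree `1`. -/
def leaves {C : Type u} (T : SimpleGraph C) : Set C :=
  {a | (T.neighborSet a).ncard = 1}

/-- The internal vertices: the vertices that are not leaves. -/
def internalVertices {C : Type u} (T : SimpleGraph C) : Set C :=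
  (leaves T)ᶜ

/-! ## The algorithm -/

/-- The bipartite graph `H`: it has a left vertex `ℓ_a` for each `a ∈ C ∖ {s, t}`, a right vertex
`r_c` for each `c ∈ C`, and the edges `ℓ_a r_c` for the arcs `(a, c)` of `D`. -/
def matchingGraph {C : Type u} (D : Digraph C) (s t : C) :
    SimpleGraph ({a : C // a ≠ s ∧ a ≠ t} ⊕ C) where
  Adj x y := (∃ a c, x = Sum.inl a ∧ y = Sum.inr c ∧ D.Adj a.1 c) ∨
    (∃ a c, y = Sum.inl a ∧ x = Sum.inr c ∧ D.Adj a.1 c)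
  symm := ⟨fun _ _ h => h.symm⟩
  loopless := ⟨by
    rintro x (⟨a, c, h1, h2, -⟩ | ⟨a, c, h1, h2, -⟩) <;> exact Sum.inl_ne_inr (h1.symm.trans h2)⟩

/-- `M` is a maximum matching of `H`. -/
def IsMaximumMatching {V : Type u} {H : SimpleGraph V} (M : H.Subgraph) : Prop :=
  M.IsMatching ∧ ∀ M' : H.Subgraph, M'.IsMatching → M'.edgeSet.ncard ≤ M.edgeSet.ncard

/-- `(D, s, t, M, f)` are the objects constructed in a possible run of the algorithm on `P`; the
run returns the tree `T(f)`. -/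
structure IsRun {C : Type u} {N : Type v} (P : Profile C N) (D : Digraph C) (s t : C)
    (M : (matchingGraph D s t).Subgraph) (f : {a : C // a ≠ t} → C) : Prop where
  /-- `D` is the attachment digraph of `P`. -/
  digraph : P.IsAttachmentDigraph D
  /-- `t` is the sink of `D`. -/
  sink : ∀ b, ¬ D.Adj t b
  /-- `s` has a unique outgoing arc, which goes to `t`. -/
  arc : ∀ b, D.Adj s b ↔ b = t
  /-- `M` is a maximum matching in `H`. -/
  matching : IsMaximumMatching M
  /-- `f(s) = t`. -/
  start : ∀ hs : s ≠ t, f ⟨s, hs⟩ = t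
  /-- If `ℓ_a` is matched to `r_c`, then `f(a) = c`. -/
  matched : ∀ (a : C) (ha : a ≠ s ∧ a ≠ t) (c : C),
    M.Adj (Sum.inl ⟨a, ha⟩) (Sum.inr c) → f ⟨a, ha.2⟩ = c
  /-- If `ℓ_a` is not matched, then `f(a)` is an arbitrary out-neighbour of `a`. -/
  unmatched : ∀ (a : C) (ha : a ≠ s ∧ a ≠ t),
    Sum.inl ⟨a, ha⟩ ∉ M.verts → D.Adj a (f ⟨a, ha.2⟩)

/-! ## A random access machine

Imperative programs over arrays of natural numbers. Elementary operations have unit cost. There is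
no multiplication, so the numbers that occur in a computation of `k` steps have length
`O(k + input length)`, and polynomial time on this machine is polynomial time in the usual sense. -/

namespace RAM

/-- The memory: entry `(i, j)` of array number `x`. A scalar variable is the entry `(0, 0)` of an
array. -/
abbrev Store := ℕ → ℕ → ℕ → ℕ

/-- The memory after the value `v` has been written to entry `(i, j)` of array `x`. -/
def Store.write (σ : Store) (x i j v : ℕ) : Store :=
  fun x' i' j' => if x' = x ∧ i' = i ∧ j' = j then v else σ x' i' j'

/-- Expressions: constants, array entries, addition, truncated subtraction, comparisons. -/
inductive Expr
  | const (k : ℕ)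
  | entry (x : ℕ) (i j : Expr)
  | plus (e₁ e₂ : Expr)
  | minus (e₁ e₂ : Expr)
  | less (e₁ e₂ : Expr)
  | equal (e₁ e₂ : Expr)

/-- The value of an expression; comparisons have value `1` (true) or `0` (false). -/
def Expr.eval (σ : Store) : Expr → ℕ
  | const k => k
  | entry x i j => σ x (i.eval σ) (j.eval σ)
  | plus e₁ e₂ => e₁.eval σ + e₂.eval σ
  | minus e₁ e₂ => e₁.eval σ - e₂.eval σ
  | less e₁ e₂ => if e₁.eval σ < e₂.eval σ then 1 else 0
  | equal e₁ e₂ => if e₁.eval σ = e₂.eval σ then 1 else 0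

/-- The number of steps needed to evaluate an expression: one for each operation in it. -/
def Expr.cost : Expr → ℕ
  | const _ => 1
  | entry _ i j => i.cost + j.cost + 1
  | plus e₁ e₂ => e₁.cost + e₂.cost + 1
  | minus e₁ e₂ => e₁.cost + e₂.cost + 1
  | less e₁ e₂ => e₁.cost + e₂.cost + 1
  | equal e₁ e₂ => e₁.cost + e₂.cost + 1

/-- Programs. -/
inductive Program
  /-- Do nothing. -/
  | skip
  /-- Write the value of `e` to entry `(i, j)` of array `x`. -/
  | assign (x : ℕ) (i j e : Expr)
  /-- First `p`, then `q`. -/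
  | seq (p q : Program)
  /-- If `e` has a nonzero value then `p`, otherwise `q`. -/
  | branch (e : Expr) (p q : Program)
  /-- As long as `e` has a nonzero value, repeat `p`. -/
  | loop (e : Expr) (p : Program)

/-- `Runs p σ k τ`: started with memory `σ`, the program `p` halts after exactly `k` steps, with
memory `τ`. -/
inductive Runs : Program → Store → ℕ → Store → Prop
  | skip (σ : Store) : Runs .skip σ 1 σ
  | assign (σ : Store) (x : ℕ) (i j e : Expr) :
      Runs (.assign x i j e) σ (i.cost + j.cost + e.cost + 1)
        (σ.write x (i.eval σ) (j.eval σ) (e.eval σ))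
  | seq {p q : Program} {σ τ υ : Store} {k l : ℕ} (hp : Runs p σ k τ) (hq : Runs q τ l υ) :
      Runs (.seq p q) σ (k + l) υ
  | branch_true {e : Expr} {p q : Program} {σ τ : Store} {k : ℕ} (he : e.eval σ ≠ 0)
      (hp : Runs p σ k τ) : Runs (.branch e p q) σ (e.cost + 1 + k) τ
  | branch_false {e : Expr} {p q : Program} {σ τ : Store} {k : ℕ} (he : e.eval σ = 0)
      (hq : Runs q σ k τ) : Runs (.branch e p q) σ (e.cost + 1 + k) τ
  | loop_stop {e : Expr} {p : Program} {σ : Store} (he : e.eval σ = 0) :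
      Runs (.loop e p) σ (e.cost + 1) σ
  | loop_step {e : Expr} {p : Program} {σ τ υ : Store} {k l : ℕ} (he : e.eval σ ≠ 0)
      (hp : Runs p σ k τ) (hl : Runs (.loop e p) τ l υ) :
      Runs (.loop e p) σ (e.cost + 1 + k + l) υ

/-- Programs are deterministic: the number of steps and the final memory are unique. -/
theorem Runs.deterministic {p : Program} {σ τ τ' : Store} {k k' : ℕ}
    (h : Runs p σ k τ) (h' : Runs p σ k' τ') : k = k' ∧ τ = τ' := by
  induction h generalizing k' τ' with
  | skip σ => cases h'; exact ⟨rfl, rfl⟩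
  | assign σ x i j e => cases h'; exact ⟨rfl, rfl⟩
  | seq hp hq ihp ihq =>
    cases h' with
    | seq hp' hq' =>
      obtain ⟨rfl, rfl⟩ := ihp hp'
      obtain ⟨rfl, rfl⟩ := ihq hq'
      exact ⟨rfl, rfl⟩
  | branch_true he hp ih =>
    cases h' with
    | branch_true he' hp' =>
      obtain ⟨rfl, rfl⟩ := ih hp'
      exact ⟨rfl, rfl⟩
    | branch_false he' hq' => exact absurd he' he
  | branch_false he hq ih =>
    cases h' with
    | branch_true he' hp' => exact absurd he he'
    | branch_false he' hq' =>
      obtain ⟨rfl, rfl⟩ := ih hq'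
      exact ⟨rfl, rfl⟩
  | loop_stop he =>
    cases h' with
    | loop_stop he' => exact ⟨rfl, rfl⟩
    | loop_step he' hp' hl' => exact absurd he he'
  | loop_step he hp hl ihp ihl =>
    cases h' with
    | loop_stop he' => exact absurd he' he
    | loop_step he' hp' hl' =>
      obtain ⟨rfl, rfl⟩ := ihp hp'
      obtain ⟨rfl, rfl⟩ := ihl hl'
      exact ⟨rfl, rfl⟩

/-- The initial memory for a profile with `m` candidates and `n` voters: entry `(i, a)` of array
`0` is `pos(i, a)`, the scalars `1` and `2` are `m` and `n`, and all other entries are `0`. -/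
noncomputable def inputStore {m n : ℕ} (P : Profile (Fin m) (Fin n)) : Store := fun x i j =>
  if x = 0 then
    if h : i < n ∧ j < m then P.pos ⟨i, h.1⟩ ⟨j, h.2⟩ else 0
  else if x = 1 ∧ i = 0 ∧ j = 0 then m
  else if x = 2 ∧ i = 0 ∧ j = 0 then n
  else 0

/-- Array `x` contains the 0-1 matrix of the relation `R`. -/
def HoldsRelation {m : ℕ} (σ : Store) (x : ℕ) (R : Fin m → Fin m → Prop) : Prop :=
  ∀ a b : Fin m, (R a b → σ x a b = 1) ∧ (¬ R a b → σ x a b = 0)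

/-- The final memory `σ` contains the objects of a run of the algorithm: the adjacency matrix of
`D` in array `3`, the vertices `s` and `t` in the scalars `4` and `5`, the matching `M` in array
`6`, the values of `f` in the first column of array `7`, and the adjacency matrix of the returned
tree `T(f)` in array `8`. -/
structure HoldsRun {m : ℕ} (σ : Store) (D : Digraph (Fin m)) (s t : Fin m)
    (M : (matchingGraph D s t).Subgraph) (f : {a : Fin m // a ≠ t} → Fin m) : Prop where
  digraph : HoldsRelation σ 3 D.Adj
  source : σ 4 0 0 = s
  sink : σ 5 0 0 = t
  matching : HoldsRelation σ 6
    (fun a c => ∃ ha : a ≠ s ∧ a ≠ t, M.Adj (Sum.inl ⟨a, ha⟩) (Sum.inr c))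
  values : ∀ a : {a : Fin m // a ≠ t}, σ 7 a.1 0 = f a
  tree : HoldsRelation σ 8 (attachmentTree f).Adj

end RAM

/-! Part (i). On a tree, single-peakedness is equivalent to a local condition: each voter prefers to
every non-favourite candidate `a` some neighbour of `a`. Indeed, repeatedly moving to a preferred
neighbour gives an improving path to the favourite, and in a tree this is the only path. The local
condition also makes sense inside a set `S` of remaining candidates. There, a candidate ranked last
by some voter has exactly one neighbour in `S`, and this neighbour lies in `B(S, a)`
(`LocallySinglePeaked.mem_attachable`). Hence no round fails, and the condition passes to the next
set (`LocallySinglePeaked.sdiff_bottoms`).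

It follows that every tree in `𝒯(P)` contains an arc of `D` out of each non-sink (`exists_adj_adj`).
Conversely, every graph that does so is locally single-peaked (`Builds.locallySinglePeaked`). As `D`
is acyclic with a single sink `t`, choosing one out-arc `(a, f(a))` per `a ≠ t` always gives a tree.
So `𝒯(P)` consists exactly of the trees `T(f)`.

Since `f(s) = t` is forced, the internal vertices of `T(f)` are the values of `f` on `C ∖ {s, t}`.
Choosing one preimage per value turns these into a matching of `H`, and extending a maximum matching
attains the bound. Fewest leaves means most internal vertices, hence the claim.

Part (ii). The algorithm is written in a small language of loops bounded by `m` and tests by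
formulas with bounded quantifiers. Every statement of this language compiles to a machine program
with a polynomial time bound, so only the functional correctness of the statement remains to be
shown. Arcs and removals are definable by formulas. The maximum matching is found by an auction with
prices at most `m`. The sum of the prices is at most `m * m`, which bounds the number of sweeps, and
a value that is not a price yields a cover of König type that proves optimality. -/

namespace Profile

variable {C : Type u} {N : Type v}

/-! ### Best, second best and worst candidates of a strict total order -/

section Order

variable (P : Profile C N)

theorem prefers_irrefl (i : N) (a : C) : ¬ P.prefers i a a :=
  have := P.isStrictTotalOrder i
  irrefl a

theorem prefers_trans {P : Profile C N} {i : N} {a b c : C} (hab : P.prefers i a b)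
    (hbc : P.prefers i b c) : P.prefers i a c :=
  have := P.isStrictTotalOrder i
  _root_.trans hab hbc

theorem prefers_asymm {P : Profile C N} {i : N} {a b : C} (hab : P.prefers i a b) :
    ¬ P.prefers i b a := fun h => P.prefers_irrefl i a (prefers_trans hab h)

theorem prefers_or (i : N) {a b : C} (hab : a ≠ b) : P.prefers i a b ∨ P.prefers i b a := by
  have := P.isStrictTotalOrder i
  rcases trichotomous_of (P.prefers i) a b with h | h | h
  exacts [Or.inl h, absurd h hab, Or.inr h]

theorem prefers_ne {P : Profile C N} {i : N} {a b : C} (hab : P.prefers i a b) : a ≠ b := by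
  rintro rfl
  exact P.prefers_irrefl i a hab

theorem wellFounded_prefers [Finite C] (i : N) : WellFounded (P.prefers i) := by
  have := P.isStrictTotalOrder i
  exact Finite.wellFounded_of_trans_of_irrefl _

theorem wellFounded_prefers_swap [Finite C] (i : N) :
    WellFounded (fun a b => P.prefers i b a) := by
  have : IsTrans C (fun a b => P.prefers i b a) := ⟨fun _ _ _ h h' => prefers_trans h' h⟩
  have : Std.Irrefl (fun a b => P.prefers i b a) := ⟨fun a => P.prefers_irrefl i a⟩
  exact Finite.wellFounded_of_trans_of_irrefl _

theorem exists_isTop [Finite C] (i : N) {S : Set C} (hS : S.Nonempty) :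
    ∃ a, P.IsTop i S a := by
  obtain ⟨a, ha, hmin⟩ := (P.wellFounded_prefers i).has_min S hS
  exact ⟨a, ha, fun b hb hba => (P.prefers_or i hba).resolve_left (hmin b hb)⟩

theorem exists_isBottom [Finite C] (i : N) {S : Set C} (hS : S.Nonempty) :
    ∃ a, P.IsBottom i S a := by
  obtain ⟨a, ha, hmin⟩ := (P.wellFounded_prefers_swap i).has_min S hS
  exact ⟨a, ha, fun b hb hba => (P.prefers_or i hba).resolve_right (hmin b hb)⟩

theorem exists_isSecond [Finite C] (i : N) {S : Set C} (hS : 3 ≤ S.ncard) :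
    ∃ a, P.IsSecond i S a := by
  obtain ⟨a, b, c, ha, hb, hc, hab, hac, hbc⟩ :=
    (Set.two_lt_ncard_iff (Set.finite_of_ncard_pos (by omega))).1 hS
  obtain ⟨t, ht⟩ := P.exists_isTop i ⟨a, ha⟩
  have : (S \ {t}).Nonempty := by
    by_cases h : a = t
    · exact ⟨b, hb, fun h' => hab (h.trans h'.symm)⟩
    · exact ⟨a, ha, h⟩
  obtain ⟨s, hs⟩ := P.exists_isTop i this
  exact ⟨s, t, ht, hs⟩

theorem IsTop.unique {P : Profile C N} {i : N} {S : Set C} {a b : C} (ha : P.IsTop i S a)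
    (hb : P.IsTop i S b) : a = b := by
  by_contra h
  exact prefers_asymm (ha.2 b hb.1 (Ne.symm h)) (hb.2 a ha.1 h)

theorem IsTop.mono {P : Profile C N} {i : N} {S S' : Set C} {a : C} (ha : P.IsTop i S a)
    (h : S' ⊆ S) (ha' : a ∈ S') : P.IsTop i S' a :=
  ⟨ha', fun b hb => ha.2 b (h hb)⟩

theorem not_isTop_iff {i : N} {S : Set C} {a : C} (ha : a ∈ S) :
    ¬ P.IsTop i S a ↔ ∃ c ∈ S, P.prefers i c a := by
  constructor
  · intro h
    by_contra! h'
    exact h ⟨ha, fun b hb hba => (P.prefers_or i hba).resolve_left (h' b hb)⟩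
  · rintro ⟨c, hc, hca⟩ h
    exact prefers_asymm hca (h.2 c hc (prefers_ne hca))

/-- The worst of at least two candidates is not the best one. -/
theorem IsBottom.not_isTop {P : Profile C N} {i : N} {S : Set C} {a : C}
    (hS : 3 ≤ S.ncard) (ha : P.IsBottom i S a) : ¬ P.IsTop i S a := by
  intro h
  obtain ⟨x, y, -, hx, hy, -, hxy, -, -⟩ :=
    (Set.two_lt_ncard_iff (Set.finite_of_ncard_pos (by omega))).1 hS
  by_cases hxa : x = a
  · have : y ≠ a := fun h' => hxy (hxa.trans h'.symm)
    exact prefers_asymm (h.2 y hy this) (ha.2 y hy this)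
  · exact prefers_asymm (h.2 x hx hxa) (ha.2 x hx hxa)

/-- The worst of at least three candidates is not the second best one. -/
theorem IsBottom.not_isSecond {P : Profile C N} {i : N} {S : Set C} {a : C}
    (hS : 3 ≤ S.ncard) (ha : P.IsBottom i S a) : ¬ P.IsSecond i S a := by
  rintro ⟨t, ht, hat⟩
  obtain ⟨x, y, z, hx, hy, hz, hxy, hxz, hyz⟩ :=
    (Set.two_lt_ncard_iff (Set.finite_of_ncard_pos (by omega))).1 hS
  -- Among three candidates of `S` one is neither `a` nor the top `t`; the voter would have to rank
  -- it both above and below `a`.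
  have key : ∃ w ∈ S, w ≠ a ∧ w ≠ t := by
    by_contra! h
    have h1 := h x hx
    have h2 := h y hy
    have h3 := h z hz
    by_cases hxa : x = a
    · exact hyz ((h2 fun h => hxy (hxa.trans h.symm)).trans (h3 fun h => hxz (hxa.trans h.symm)).symm)
    · by_cases hya : y = a
      · exact hxz ((h1 hxa).trans (h3 fun h => hyz (hya.trans h.symm)).symm)
      · exact hxy ((h1 hxa).trans (h2 hya).symm)
  obtain ⟨w, hw, hwa, hwt⟩ := key
  exact prefers_asymm (ha.2 w hw hwa) (hat.2 w ⟨hw, hwt⟩ hwa)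

theorem bottoms_subset (S : Set C) : P.bottoms S ⊆ S := fun _ ⟨_, h⟩ => h.1

/-- A voter `j` who ranks `c` last neither prefers `c` to `a` nor has `c` in second place, so `j`
excludes `c` from the intersection. Arcs therefore lead to candidates that survive the round. -/
theorem attachable_subset_sdiff [Nonempty N] {S : Set C} (hS : 3 ≤ S.ncard) {a : C}
    (ha : a ∈ S) : P.attachable S a ⊆ S \ P.bottoms S := by
  intro c hc
  have hc' : ∀ i, c ∈ P.attachableFor i S a := Set.mem_iInter.1 hc
  obtain ⟨i⟩ := ‹Nonempty N›
  refine ⟨?_, ?_⟩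
  · rcases hc' i with h | ⟨-, t, -, h⟩
    exacts [h.2.1, h.1.1]
  · rintro ⟨j, hj⟩
    rcases hc' j with h | h
    · exact prefers_asymm h.2.2 (hj.2 a ha (prefers_ne h.2.2).symm)
    · exact hj.not_isSecond hS h.2

theorem bottoms_nonempty [Finite C] [Nonempty N] {S : Set C} (hS : S.Nonempty) :
    (P.bottoms S).Nonempty := by
  obtain ⟨i⟩ := ‹Nonempty N›
  obtain ⟨a, ha⟩ := P.exists_isBottom i hS
  exact ⟨a, i, ha⟩

end Order

/-! ## A local form of single-peakedness -/

/-- Within `S`, every voter prefers some neighbour in `T` of each candidate that is not the best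
one in `S`. -/
def LocallySinglePeaked (P : Profile C N) (T : SimpleGraph C) (S : Set C) : Prop :=
  ∀ i, ∀ a ∈ S, ¬ P.IsTop i S a → ∃ b ∈ S, T.Adj a b ∧ P.prefers i b a

/-- Moving to a preferred neighbour can be repeated until the top is reached. Each step strictly
improves the rank, so no vertex is repeated. -/
theorem LocallySinglePeaked.exists_path [Finite C] {P : Profile C N} {T : SimpleGraph C}
    {S : Set C} (h : P.LocallySinglePeaked T S) {i : N} {t : C} (ht : P.IsTop i S t) (a : C)
    (ha : a ∈ S) :
    ∃ p : T.Walk a t, p.IsPath ∧ ∀ x ∈ p.support, x = a ∨ P.prefers i x a := by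
  induction a using (P.wellFounded_prefers i).induction with
  | _ a ih =>
    by_cases hat : P.IsTop i S a
    · obtain rfl := hat.unique ht
      exact ⟨.nil, .nil, fun x hx => Or.inl (by simpa using hx)⟩
    · obtain ⟨b, hb, hab, hba⟩ := h i a ha hat
      obtain ⟨p, hp, hsup⟩ := ih b hba hb
      have hsup' : ∀ x ∈ p.support, P.prefers i x a := fun x hx => by
        rcases hsup x hx with rfl | h
        exacts [hba, prefers_trans h hba]
      refine ⟨.cons hab p, hp.cons fun h => P.prefers_irrefl i a (hsup' a h), fun x hx => ?_⟩
      rw [SimpleGraph.Walk.support_cons, List.mem_cons] at hx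
      exact hx.imp id (hsup' x)

/-- The required neighbour of `a` is the next vertex on the path from `a` to the favourite. -/
theorem SinglePeakedOn.locallySinglePeaked [Finite C] {P : Profile C N} {T : SimpleGraph C}
    (hT : T.Connected) (h : P.SinglePeakedOn T) : P.LocallySinglePeaked T Set.univ := by
  classical
  intro i a _ ha
  obtain ⟨t, ht⟩ := P.exists_isTop i (S := Set.univ) ⟨a, trivial⟩
  have hat : a ≠ t := fun h => ha (h ▸ ht)
  obtain ⟨p, hp⟩ := (hT.preconnected a t).exists_isPath
  cases p with
  | nil => exact absurd rfl hat
  | @cons _ b _ hab p =>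
    refine ⟨b, trivial, hab, ?_⟩
    by_cases hbt : b = t
    · exact hbt ▸ ht.2 a trivial hat
    · exact (h i t a b ht hab.ne hbt _ hp.reverse (by simp)).2

/-- Paths in an acyclic graph are unique, so the given path is the improving one of `exists_path`,
reversed. -/
theorem LocallySinglePeaked.singlePeakedOn [Finite C] {P : Profile C N} {T : SimpleGraph C}
    (hT : T.IsAcyclic) (h : P.LocallySinglePeaked T Set.univ) : P.SinglePeakedOn T := by
  intro i t a b ht hab hbt p hp hb
  obtain ⟨q, hq, hsup⟩ := h.exists_path ht a trivial
  have : p = q.reverse :=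
    congrArg Subtype.val ((hT.subsingleton_path t a).elim ⟨p, hp⟩ ⟨q.reverse, hq.reverse⟩)
  rw [this, SimpleGraph.Walk.support_reverse, List.mem_reverse] at hb
  exact ⟨ht.2 b trivial hbt, (hsup b hb).resolve_left (Ne.symm hab)⟩

/-! ## Rounds of the construction on a single-peaked profile -/

theorem LocallySinglePeaked.exists_neighbor {P : Profile C N} {T : SimpleGraph C} {S : Set C}
    (h : P.LocallySinglePeaked T S) (hS : 3 ≤ S.ncard) {a : C} (ha : a ∈ P.bottoms S) : ∃ b ∈ S, T.Adj a b := by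
  obtain ⟨i, hi⟩ := ha
  obtain ⟨b, hb, hab, -⟩ := h i a hi.1 (hi.not_isTop hS)
  exact ⟨b, hb, hab⟩

section Rounds

variable [Finite C] {P : Profile C N} {T : SimpleGraph C} {S : Set C}

/-- If voter `i` ranks `a` last, an improving path from a neighbour `d` to the top never returns to
`a`. Prefixing the edge from `a` gives a path from `a` to the top with second vertex `d`; as this
path is unique, so is `d`. -/
theorem LocallySinglePeaked.neighbor_unique (hT : T.IsAcyclic) (h : P.LocallySinglePeaked T S)
    {a b c : C} (ha : a ∈ P.bottoms S) (hb : b ∈ S) (hc : c ∈ S) (hab : T.Adj a b)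
    (hac : T.Adj a c) : b = c := by
  obtain ⟨i, hi⟩ := ha
  obtain ⟨t, ht⟩ := P.exists_isTop i ⟨a, hi.1⟩
  have key : ∀ d ∈ S, T.Adj a d → ∃ p : T.Walk a t, p.IsPath ∧ p.snd = d := by
    intro d hd had
    obtain ⟨p, hp, hsup⟩ := h.exists_path ht d hd
    refine ⟨.cons had p, hp.cons fun hap => ?_, by simp⟩
    have hda := hi.2 d hd had.ne'
    rcases hsup a hap with h | h
    exacts [had.ne h, prefers_asymm h hda]
  obtain ⟨p, hp, rfl⟩ := key b hb hab
  obtain ⟨q, hq, rfl⟩ := key c hc hac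
  have : p = q := congrArg Subtype.val ((hT.subsingleton_path a t).elim ⟨p, hp⟩ ⟨q, hq⟩)
  rw [this]

/-- A voter whose top is not `a` prefers some neighbour of `a` in `S`, and there is only one. If `a`
is the top, the only candidate better than the second one is `a`, so local single-peakedness makes
the second one adjacent to `a`, and it is again the unique neighbour. -/
theorem LocallySinglePeaked.mem_attachable (hT : T.IsAcyclic) (h : P.LocallySinglePeaked T S)
    (hS : 3 ≤ S.ncard) {a b : C} (ha : a ∈ P.bottoms S) (hb : b ∈ S) (hab : T.Adj a b) :
    b ∈ P.attachable S a := by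
  have haS := P.bottoms_subset S ha
  refine Set.mem_iInter.2 fun i => ?_
  by_cases hat : P.IsTop i S a
  · obtain ⟨d, t, ht, hd⟩ := P.exists_isSecond i hS
    obtain rfl := ht.unique hat
    have hdt : ¬ P.IsTop i S d := fun h' => hd.1.2 (h'.unique ht)
    obtain ⟨e, he, hde, hed⟩ := h i d hd.1.1 hdt
    have : e = t := by
      by_contra hne
      exact prefers_asymm hed (hd.2 e ⟨he, hne⟩ hde.ne')
    subst this
    obtain rfl := h.neighbor_unique hT ha hb hd.1.1 hab hde.symm
    exact Or.inr ⟨hat, e, ht, hd⟩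
  · obtain ⟨c, hc, hac, hca⟩ := h i a haS hat
    obtain rfl := h.neighbor_unique hT ha hb hc hab hac
    exact Or.inl ⟨hat, hb, hca⟩

theorem LocallySinglePeaked.attachable_nonempty (hT : T.IsAcyclic)
    (h : P.LocallySinglePeaked T S) (hS : 3 ≤ S.ncard) {a : C} (ha : a ∈ P.bottoms S) :
    (P.attachable S a).Nonempty := by
  obtain ⟨b, hb, hab⟩ := h.exists_neighbor hS ha
  exact ⟨b, h.mem_attachable hT hS ha hb hab⟩

/-- Suppose that the improving neighbour `b` of `a` is removed. Then `a ∈ B(S, b)`, although the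
voter prefers `b` to `a`. This is possible only if `b` is the top and `a` the second, and then `a`
is the top of what remains. -/
theorem LocallySinglePeaked.sdiff_bottoms (hT : T.IsAcyclic) (h : P.LocallySinglePeaked T S)
    (hS : 3 ≤ S.ncard) : P.LocallySinglePeaked T (S \ P.bottoms S) := by
  intro i a ha hat
  have haS : ¬ P.IsTop i S a := fun h' => hat (h'.mono Set.sdiff_subset ha)
  obtain ⟨b, hb, hab, hba⟩ := h i a ha.1 haS
  by_cases hbL : b ∈ P.bottoms S
  · exfalso
    have hmem := Set.mem_iInter.1 (h.mem_attachable hT hS hbL ha.1 hab.symm) i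
    rcases hmem with h' | ⟨hbt, t, ht, hat'⟩
    · exact prefers_asymm h'.2.2 hba
    · obtain rfl := hbt.unique ht
      refine hat (hat'.mono (fun x hx => ⟨hx.1, ?_⟩) ha)
      rintro rfl
      exact hx.2 hbL
  · exact ⟨b, ⟨hb, hbL⟩, hab, hba⟩

theorem LocallySinglePeaked.sdiff_bottoms_nonempty [Nonempty N] (hT : T.IsAcyclic)
    (h : P.LocallySinglePeaked T S) (hS : 3 ≤ S.ncard) : (S \ P.bottoms S).Nonempty := by
  obtain ⟨a, ha⟩ := P.bottoms_nonempty (S := S) (Set.nonempty_of_ncard_ne_zero (by omega))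
  exact (h.attachable_nonempty hT hS ha).mono
    (P.attachable_subset_sdiff hS (P.bottoms_subset S ha))

end Rounds

/-! ## Attachment digraphs -/

theorem Builds.mem [Nonempty N] {P : Profile C N} {S : Set C} {D : Digraph C} (h : P.Builds S D)
    {a b : C} (hab : D.Adj a b) :
    a ∈ S ∧ b ∈ S := by
  induction h with
  | small => exact hab.elim
  | pair x y hxy =>
    obtain ⟨rfl, rfl⟩ := hab
    simp
  | round S D hS hB hD ih =>
    rcases hab with ⟨ha, hb⟩ | hab
    · have ha' := P.bottoms_subset S ha
      exact ⟨ha', (P.attachable_subset_sdiff hS ha' hb).1⟩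
    · exact ⟨(ih hab).1.1, (ih hab).2.1⟩

section Builds

variable [Finite C] [Nonempty N] {P : Profile C N}

theorem ncard_sdiff_bottoms_lt (P : Profile C N) {S : Set C} (hS : S.Nonempty) :
    (S \ P.bottoms S).ncard < S.ncard := by
  obtain ⟨a, ha⟩ := P.bottoms_nonempty hS
  exact Set.ncard_lt_ncard ⟨Set.sdiff_subset, fun h => (h (P.bottoms_subset S ha)).2 ha⟩

theorem LocallySinglePeaked.exists_builds {T : SimpleGraph C} (hT : T.IsAcyclic) {S : Set C}
    (h : P.LocallySinglePeaked T S) : ∃ D, P.Builds S D := by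
  induction hn : S.ncard using Nat.strong_induction_on generalizing S with
  | _ n ih =>
    by_cases h3 : 3 ≤ S.ncard
    · obtain ⟨D, hD⟩ := ih _ (hn ▸ P.ncard_sdiff_bottoms_lt
        (Set.nonempty_of_ncard_ne_zero (by omega))) (h.sdiff_bottoms hT h3) rfl
      exact ⟨_, .round S D h3 (fun a ha => h.attachable_nonempty hT h3 ha) hD⟩
    · by_cases h2 : S.ncard = 2
      · obtain ⟨a, b, hab, rfl⟩ := Set.ncard_eq_two.1 h2
        exact ⟨_, .pair a b hab⟩
      · exact ⟨_, .small S (Set.ncard_le_one_iff_subsingleton.1 (by omega))⟩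

end Builds

end Profile

/-! ### Sink, source and acyclicity of attachment digraphs, and the trees they contain -/

namespace Profile

variable {C : Type u} {N : Type v}

/-- Every removed candidate has an out-arc because the sets `B(S, a)` are nonempty, so a sink
survives all rounds; of a final pair only the head of the last arc is a sink. -/
theorem Builds.sink_unique {P : Profile C N} {S : Set C} {D : Digraph C}
    (h : P.Builds S D) {a b : C} (ha : a ∈ S)
    (hb : b ∈ S) (ha' : ∀ c, ¬ D.Adj a c) (hb' : ∀ c, ¬ D.Adj b c) : a = b := by
  induction h with
  | small S hS => exact hS ha hb
  | pair x y hxy =>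
    have key : ∀ c ∈ ({x, y} : Set C), (∀ d, ¬ (c = x ∧ d = y)) → c = y := fun c hc h => by
      rcases hc with rfl | rfl
      exacts [absurd ⟨rfl, rfl⟩ (h y), rfl]
    rw [key a ha ha', key b hb hb']
  | round S D hS hB hD ih =>
    have key : ∀ c ∈ S, (∀ d, ¬ ((c ∈ P.bottoms S ∧ d ∈ P.attachable S c) ∨ D.Adj c d)) →
        c ∈ S \ P.bottoms S := fun c hc h => ⟨hc, fun hcL => by
      obtain ⟨d, hd⟩ := hB c hcL
      exact h d (Or.inl ⟨hcL, hd⟩)⟩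
    exact ih (key a ha ha') (key b hb hb') (fun c hc => ha' c (Or.inr hc))
      (fun c hc => hb' c (Or.inr hc))

theorem Builds.exists_adj {P : Profile C N} {D : Digraph C} (h : P.Builds Set.univ D) {t : C}
    (ht : ∀ b, ¬ D.Adj t b) {a : C} (ha : a ≠ t) : ∃ b, D.Adj a b := by
  by_contra! h'
  exact ha (h.sink_unique trivial trivial h' ht)

variable [Nonempty N] {P : Profile C N} {S : Set C} {D : Digraph C}

/-- Arcs added in a round go from removed to remaining candidates, and later arcs stay among the
remaining ones, so there is no infinite walk along arcs. -/
theorem Builds.acc (h : P.Builds S D) (a : C) : Acc (fun b a => D.Adj a b) a := by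
  induction h generalizing a with
  | small => exact ⟨_, fun _ h => h.elim⟩
  | pair x y hxy =>
    refine ⟨_, ?_⟩
    rintro b ⟨rfl, rfl⟩
    exact ⟨_, fun c hc => absurd hc.1 hxy.symm⟩
  | round S D hS hB hD ih =>
    have key : ∀ x ∉ P.bottoms S, Acc (fun b a => (a ∈ P.bottoms S ∧ b ∈ P.attachable S a) ∨
        D.Adj a b) x := by
      intro x
      induction ih x with
      | intro x _ ihx =>
        intro hx
        refine ⟨_, fun y hy => ?_⟩
        have hxy := hy.resolve_left fun h => hx h.1
        exact ihx y hxy (hD.mem hxy).2.2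
    by_cases ha : a ∈ P.bottoms S
    · refine ⟨_, fun b hb => key b ?_⟩
      rcases hb with hb | hb
      · exact (P.attachable_subset_sdiff hS (P.bottoms_subset S ha) hb.2).2
      · exact (hD.mem hb).2.2
    · exact key a ha

theorem Builds.wellFounded (h : P.Builds S D) : WellFounded (fun b a => D.Adj a b) :=
  ⟨h.acc⟩

theorem Builds.asymm (h : P.Builds S D) {a b : C} (hab : D.Adj a b) : ¬ D.Adj b a :=
  h.wellFounded.asymmetric _ _ hab

theorem Builds.ne (h : P.Builds S D) {a b : C} (hab : D.Adj a b) : a ≠ b := by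
  rintro rfl
  exact h.asymm hab hab

theorem Builds.exists_sink [Nonempty C] (h : P.Builds S D) : ∃ t, ∀ b, ¬ D.Adj t b := by
  obtain ⟨t, -, ht⟩ := h.wellFounded.has_min Set.univ Set.univ_nonempty
  exact ⟨t, fun b => ht b trivial⟩

/-- If two candidates are left, the tail of the last arc serves as `s`. If a round leaves only the
sink, any candidate removed in that round does, as its nonempty set `B(S, s)` is contained in what
remains. -/
theorem Builds.exists_source [Finite C] (h : P.Builds S D) {t : C} (htS : t ∈ S)
    (ht : ∀ b, ¬ D.Adj t b) (hS : 2 ≤ S.ncard) : ∃ s, ∀ b, D.Adj s b ↔ b = t := by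
  induction h with
  | small S hS' => exact absurd (Set.ncard_le_one_iff_subsingleton.2 hS') (by omega)
  | pair x y hxy =>
    have hty : t = y := by
      rcases htS with rfl | rfl
      exacts [absurd ⟨rfl, rfl⟩ (ht y), rfl]
    exact ⟨x, fun b => by simp [hty]⟩
  | round S D hS3 hB hD ih =>
    have htL : t ∈ S \ P.bottoms S := ⟨htS, fun htL => by
      obtain ⟨d, hd⟩ := hB t htL
      exact ht d (Or.inl ⟨htL, hd⟩)⟩
    have ht' : ∀ b, ¬ D.Adj t b := fun b hb => ht b (Or.inr hb)
    by_cases h2 : 2 ≤ (S \ P.bottoms S).ncard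
    · obtain ⟨s, hs⟩ := ih htL ht' h2
      have hsL := (hD.mem ((hs t).2 rfl)).1.2
      exact ⟨s, fun b => by simp [hsL, hs]⟩
    · have hsub : (S \ P.bottoms S).Subsingleton :=
        Set.ncard_le_one_iff_subsingleton.1 (by omega)
      obtain ⟨s, hs⟩ := P.bottoms_nonempty ⟨t, htS⟩
      have hatt : ∀ b, b ∈ P.attachable S s → b = t := fun b hb =>
        hsub (P.attachable_subset_sdiff hS3 (P.bottoms_subset S hs) hb) htL
      refine ⟨s, fun b => ⟨?_, ?_⟩⟩
      · rintro (h' | h')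
        · exact hatt b h'.2
        · exact absurd hs (hD.mem h').1.2
      · rintro rfl
        obtain ⟨c, hc⟩ := hB s hs
        exact Or.inl ⟨hs, hatt c hc ▸ hc⟩

/-- A tree on which the profile is single-peaked contains an outgoing arc of each candidate. -/
theorem LocallySinglePeaked.exists_adj_adj [Finite C] {T : SimpleGraph C} (hT : T.IsAcyclic)
    (h : P.LocallySinglePeaked T S) (hD : P.Builds S D) {a b : C} (hab : D.Adj a b) :
    ∃ c, D.Adj a c ∧ T.Adj a c := by
  induction hD with
  | small => exact hab.elim
  | pair x y hxy =>
    obtain ⟨rfl, rfl⟩ := hab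
    refine ⟨b, ⟨rfl, rfl⟩, ?_⟩
    obtain ⟨i⟩ := ‹Nonempty N›
    -- Whichever of the two candidates voter `i` likes less has a preferred neighbour within the
    -- pair, which can only be the other one.
    rcases P.prefers_or i hxy with hp | hp
    · obtain ⟨c, hc, hbc, hcb⟩ := h i b (by simp) ((P.not_isTop_iff (by simp)).2 ⟨a, by simp, hp⟩)
      rcases hc with rfl | rfl
      exacts [hbc.symm, absurd rfl hbc.ne]
    · obtain ⟨c, hc, hac, hca⟩ := h i a (by simp) ((P.not_isTop_iff (by simp)).2 ⟨b, by simp, hp⟩)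
      rcases hc with rfl | rfl
      exacts [absurd rfl hac.ne, hac]
  | round S D hS hB hD ih =>
    rcases hab with ⟨ha, -⟩ | hab
    · obtain ⟨c, hc, hac⟩ := h.exists_neighbor hS ha
      exact ⟨c, Or.inl ⟨ha, h.mem_attachable hT hS ha hc hac⟩, hac⟩
    · obtain ⟨c, hc, hac⟩ := ih (h.sdiff_bottoms hT hS) hab
      exact ⟨c, Or.inr hc, hac⟩

/-- A graph that contains an outgoing arc of each candidate is locally single-peaked. -/
theorem Builds.locallySinglePeaked [Finite C] {G : SimpleGraph C} (hD : P.Builds S D)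
    (h : ∀ a b, D.Adj a b → ∃ c, D.Adj a c ∧ G.Adj a c) : P.LocallySinglePeaked G S := by
  induction hD with
  | small S hS =>
    intro i a ha hat
    exact absurd ⟨ha, fun b hb hba => absurd (hS hb ha) hba⟩ hat
  | pair x y hxy =>
    obtain ⟨c, hc, hxc⟩ := h x y ⟨rfl, rfl⟩
    obtain rfl := hc.2
    intro i a ha hat
    obtain ⟨b, hb, hba⟩ := (P.not_isTop_iff ha).1 hat
    refine ⟨b, hb, ?_, hba⟩
    rcases ha with rfl | rfl <;> rcases hb with rfl | rfl
    exacts [absurd hba (P.prefers_irrefl i _), hxc, hxc.symm, absurd hba (P.prefers_irrefl i _)]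
  | round S D hS hB hD ih =>
    have ih' : P.LocallySinglePeaked G (S \ P.bottoms S) := ih fun a b hab => by
      obtain ⟨c, hc, hac⟩ := h a b (Or.inr hab)
      exact ⟨c, hc.resolve_left fun h' => (hD.mem hab).1.2 h'.1, hac⟩
    have hbot : ∀ a ∈ P.bottoms S, ∃ c, c ∈ P.attachable S a ∧ G.Adj a c := fun a ha => by
      obtain ⟨d, hd⟩ := hB a ha
      obtain ⟨c, hc, hac⟩ := h a d (Or.inl ⟨ha, hd⟩)
      exact ⟨c, (hc.resolve_right fun h' => (hD.mem h').1.2 ha).2, hac⟩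
    intro i a ha hat
    by_cases haL : a ∈ P.bottoms S
    · obtain ⟨c, hc, hac⟩ := hbot a haL
      have := (Set.mem_iInter.1 hc i).resolve_right fun h => hat h.1
      exact ⟨c, this.2.1, hac, this.2.2⟩
    · by_cases hat' : P.IsTop i (S \ P.bottoms S) a
      -- Here `a` is the best remaining candidate but not the best in `S`, so the top `t` is being
      -- removed. For this voter an attachment point of `t` must be second in `S`, and since it
      -- survives the round, it is `a`. The edge at `t` thus joins `a` to a better candidate.
      · obtain ⟨t, ht⟩ := P.exists_isTop i ⟨a, ha⟩
        have hta : t ≠ a := fun h => hat (h ▸ ht)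
        have htL : t ∈ P.bottoms S := by
          by_contra htL
          exact hta ((ht.mono Set.sdiff_subset ⟨ht.1, htL⟩).unique hat')
        obtain ⟨c, hc, htc⟩ := hbot t htL
        have hcS := P.attachable_subset_sdiff hS ht.1 hc
        rcases Set.mem_iInter.1 hc i with h' | ⟨-, t', ht', hc'⟩
        · exact absurd ht h'.1
        · obtain rfl := ht.unique ht'
          have := (hc'.mono (fun x hx => ⟨hx.1, fun h => hx.2 (h ▸ htL)⟩) hcS).unique hat'
          subst this
          exact ⟨t, ht.1, htc.symm, ht.2 c ha hta.symm⟩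
      · obtain ⟨b, hb, hab, hba⟩ := ih' i a ⟨ha, haL⟩ hat'
        exact ⟨b, hb.1, hab, hba⟩

end Profile

/-! ## Attachment functions -/

section AttachmentTree

variable {C : Type u} {t : C} {f : {a : C // a ≠ t} → C}

theorem attachmentTree_adj {x y : C} : (attachmentTree f).Adj x y ↔
    x ≠ y ∧ ((∃ h : x ≠ t, f ⟨x, h⟩ = y) ∨ ∃ h : y ≠ t, f ⟨y, h⟩ = x) := by
  rw [attachmentTree, SimpleGraph.fromEdgeSet_adj, and_comm]
  refine and_congr_right fun _ => ⟨?_, ?_⟩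
  · rintro ⟨⟨a, ha⟩, h⟩
    rcases Sym2.eq_iff.1 h with ⟨rfl, rfl⟩ | ⟨rfl, rfl⟩
    exacts [Or.inl ⟨ha, rfl⟩, Or.inr ⟨ha, rfl⟩]
  · rintro (⟨h, rfl⟩ | ⟨h, rfl⟩)
    exacts [⟨⟨x, h⟩, rfl⟩, ⟨⟨y, h⟩, Sym2.eq_swap⟩]

/-- Following `f` ends in `t` since `D` has no infinite walks, so the graph is connected; and it has
at most one edge for each `a ≠ t`. -/
theorem attachmentTree_isTree [Finite C] {D : Digraph C}
    (hD : WellFounded (fun b a => D.Adj a b)) (hf : ∀ a, D.Adj a.1 (f a)) :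
    (attachmentTree f).IsTree := by
  have hne : ∀ a, a.1 ≠ f a := fun a h => hD.irrefl.irrefl a.1 (by simpa [← h] using hf a)
  have hreach : ∀ a, (attachmentTree f).Reachable a t := by
    intro a
    induction a using hD.induction with
    | _ a ih =>
      by_cases hat : a = t
      · rw [hat]
      · refine SimpleGraph.Reachable.trans (SimpleGraph.Adj.reachable ?_) (ih _ (hf ⟨a, hat⟩))
        exact attachmentTree_adj.2 ⟨hne ⟨a, hat⟩, Or.inl ⟨hat, rfl⟩⟩
  have hconn : (attachmentTree f).Connected :=
    { preconnected := fun a b => (hreach a).trans (hreach b).symm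
      nonempty := ⟨t⟩ }
  refine SimpleGraph.isTree_iff_connected_and_card.2 ⟨hconn, le_antisymm ?_
    hconn.card_vert_le_card_edgeSet_add_one⟩
  have hsub : (attachmentTree f).edgeSet ⊆ Set.range fun a : {a : C // a ≠ t} => s(a.1, f a) := by
    rw [attachmentTree, SimpleGraph.edgeSet_fromEdgeSet]
    rintro _ ⟨⟨a, rfl⟩, -⟩
    exact ⟨a, rfl⟩
  have h1 : Nat.card (attachmentTree f).edgeSet ≤ Nat.card {a : C // a ≠ t} :=
    (Nat.card_mono (Set.toFinite _) hsub).trans (Finite.card_range_le _)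
  have h2 : Nat.card {a : C // a ≠ t} + 1 = Nat.card C := by
    have := Set.ncard_add_ncard_compl ({t} : Set C)
    rw [Set.ncard_singleton] at this
    rw [← this, add_comm]
    rfl
  omega

end AttachmentTree

/-! ## Matchings of the bipartite graph -/

section Matching

variable {C : Type u} {D : Digraph C} {s t : C}

theorem matchingGraph_adj {a : {a : C // a ≠ s ∧ a ≠ t}} {c : C} :
    (matchingGraph D s t).Adj (Sum.inl a) (Sum.inr c) ↔ D.Adj a.1 c := by
  constructor
  · rintro (⟨b, d, h, h', hD⟩ | ⟨b, d, h, -, -⟩)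
    · rwa [Sum.inl_injective h, Sum.inr_injective h']
    · exact absurd h.symm Sum.inl_ne_inr
  · exact fun h => Or.inl ⟨a, c, rfl, rfl, h⟩

theorem matchingGraph_adj_inl {a : {a : C // a ≠ s ∧ a ≠ t}} {x}
    (h : (matchingGraph D s t).Adj (Sum.inl a) x) : ∃ c, x = Sum.inr c := by
  rcases h with ⟨b, c, -, h, -⟩ | ⟨b, c, -, h, -⟩
  exacts [⟨c, h⟩, absurd h Sum.inl_ne_inr]

theorem matchingGraph_adj_inr {c : C} {x} (h : (matchingGraph D s t).Adj (Sum.inr c) x) :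
    ∃ a, x = Sum.inl a := by
  rcases h with ⟨b, c, h, -, -⟩ | ⟨b, c, h, -, -⟩
  exacts [absurd h Sum.inr_ne_inl, ⟨b, h⟩]

variable {M : (matchingGraph D s t).Subgraph}

/-- The right vertices that are matched by `M`. -/
def matchedRight (M : (matchingGraph D s t).Subgraph) : Set C :=
  {c | ∃ a, M.Adj (Sum.inl a) (Sum.inr c)}

/-- Each edge of `H` has exactly one right end, and an edge of a matching is determined by it. -/
theorem ncard_edgeSet_eq (hM : M.IsMatching) : M.edgeSet.ncard = (matchedRight M).ncard := by
  classical
  symm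
  refine Set.ncard_congr (fun c hc => s(Sum.inl hc.choose, Sum.inr c)) ?_ ?_ ?_
  · intro c hc
    exact hc.choose_spec
  · intro c c' hc hc' h
    rcases Sym2.eq_iff.1 h with ⟨-, h⟩ | ⟨h, -⟩
    exacts [Sum.inr_injective h, absurd h Sum.inl_ne_inr]
  · intro e he
    induction e with
    | _ x y =>
      have hxy : M.Adj x y := he
      have key : ∀ a c, M.Adj (Sum.inl a) (Sum.inr c) →
          ∃ (d : C) (hd : d ∈ matchedRight M), s(Sum.inl hd.choose, Sum.inr d) =
            (s(Sum.inl a, Sum.inr c) : Sym2 ({a : C // a ≠ s ∧ a ≠ t} ⊕ C)) := fun a c h =>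
        have hc : c ∈ matchedRight M := ⟨a, h⟩
        ⟨c, hc, by rw [hM.eq_of_adj_right hc.choose_spec h]⟩
      rcases x with a | c
      · obtain ⟨c, rfl⟩ := matchingGraph_adj_inl hxy.adj_sub
        exact key a c hxy
      · obtain ⟨a, rfl⟩ := matchingGraph_adj_inr hxy.adj_sub
        rw [Sym2.eq_swap (a := Sum.inr c)]
        exact key a c hxy.symm

/-- The subgraph of the bipartite graph given by a relation between candidates. -/
def matchingOf {R : {a : C // a ≠ s ∧ a ≠ t} → C → Prop} (hR : ∀ a c, R a c → D.Adj a.1 c) :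
    (matchingGraph D s t).Subgraph where
  verts := {x | (∃ a c, x = Sum.inl a ∧ R a c) ∨ ∃ a c, x = Sum.inr c ∧ R a c}
  Adj x y := ∃ a c, R a c ∧ (x = Sum.inl a ∧ y = Sum.inr c ∨ y = Sum.inl a ∧ x = Sum.inr c)
  adj_sub := by
    rintro x y ⟨a, c, h, ⟨rfl, rfl⟩ | ⟨rfl, rfl⟩⟩
    · exact matchingGraph_adj.2 (hR a c h)
    · exact (matchingGraph_adj.2 (hR a c h)).symm
  edge_vert := by
    rintro x y ⟨a, c, h, ⟨rfl, rfl⟩ | ⟨rfl, rfl⟩⟩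
    · exact Or.inl ⟨a, c, rfl, h⟩
    · exact Or.inr ⟨a, c, rfl, h⟩
  symm := ⟨by
    rintro x y ⟨a, c, h, h'⟩
    exact ⟨a, c, h, h'.symm⟩⟩

theorem matchingOf_adj {R : {a : C // a ≠ s ∧ a ≠ t} → C → Prop}
    (hR : ∀ a c, R a c → D.Adj a.1 c) {a c} :
    (matchingOf hR).Adj (Sum.inl a) (Sum.inr c) ↔ R a c := by
  constructor
  · rintro ⟨b, d, h, ⟨h1, h2⟩ | ⟨h1, -⟩⟩
    · rwa [Sum.inl_injective h1, Sum.inr_injective h2]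
    · exact absurd h1.symm Sum.inl_ne_inr
  · exact fun h => ⟨a, c, h, Or.inl ⟨rfl, rfl⟩⟩

theorem matchingOf_isMatching {R : {a : C // a ≠ s ∧ a ≠ t} → C → Prop}
    (hR : ∀ a c, R a c → D.Adj a.1 c) (hl : ∀ a c c', R a c → R a c' → c = c')
    (hr : ∀ a a' c, R a c → R a' c → a = a') : (matchingOf hR).IsMatching := by
  rintro x (⟨a, c, rfl, h⟩ | ⟨a, c, rfl, h⟩)
  · refine ⟨Sum.inr c, ⟨a, c, h, Or.inl ⟨rfl, rfl⟩⟩, ?_⟩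
    rintro y ⟨a', c', h', ⟨ha, rfl⟩ | ⟨-, ha⟩⟩
    · obtain rfl := Sum.inl_injective ha
      rw [hl _ _ _ h h']
    · exact absurd ha Sum.inl_ne_inr
  · refine ⟨Sum.inl a, ⟨a, c, h, Or.inr ⟨rfl, rfl⟩⟩, ?_⟩
    rintro y ⟨a', c', h', ⟨hc, -⟩ | ⟨rfl, hc⟩⟩
    · exact absurd hc Sum.inr_ne_inl
    · obtain rfl := Sum.inr_injective hc
      rw [hr _ _ _ h h']

theorem matchedRight_matchingOf {R : {a : C // a ≠ s ∧ a ≠ t} → C → Prop}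
    (hR : ∀ a c, R a c → D.Adj a.1 c) : matchedRight (matchingOf hR) = {c | ∃ a, R a c} := by
  ext c
  simp [matchedRight, matchingOf_adj]

/-- A maximum matching is at least as large as the image of any function along arcs. -/
theorem IsMaximumMatching.ncard_range_le (hM : IsMaximumMatching M)
    {g : {a : C // a ≠ s ∧ a ≠ t} → C} (hg : ∀ a, D.Adj a.1 (g a)) :
    (Set.range g).ncard ≤ M.edgeSet.ncard := by
  -- Each value `c` of `g` is matched to one chosen preimage. Distinct values have distinct
  -- preimages, so this is a matching with one edge per value.
  have hR : ∀ a c, (∃ h : c ∈ Set.range g, h.choose = a) → D.Adj a.1 c := by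
    rintro a c ⟨h, rfl⟩
    conv_rhs => rw [← h.choose_spec]
    exact hg _
  have hm : (matchingOf hR).IsMatching := by
    refine matchingOf_isMatching hR ?_ ?_
    · rintro a c c' ⟨h, ha⟩ ⟨h', ha'⟩
      rw [← h.choose_spec, ← h'.choose_spec, ha, ha']
    · rintro a a' c ⟨h, rfl⟩ ⟨h', rfl⟩
      rfl
  refine le_of_eq_of_le ?_ (hM.2 _ hm)
  rw [ncard_edgeSet_eq hm, matchedRight_matchingOf]
  congr 1
  ext c
  exact ⟨fun h => ⟨_, h, rfl⟩, fun ⟨_, h, _⟩ => h⟩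

theorem exists_isMaximumMatching [Finite C] (D : Digraph C) (s t : C) :
    ∃ M : (matchingGraph D s t).Subgraph, IsMaximumMatching M := by
  have : Nonempty {M : (matchingGraph D s t).Subgraph // M.IsMatching} :=
    ⟨⊥, fun v hv => hv.elim⟩
  obtain ⟨M, hM⟩ := Finite.exists_max
    fun M : {M : (matchingGraph D s t).Subgraph // M.IsMatching} => M.1.edgeSet.ncard
  exact ⟨M.1, M.2, fun M' h => hM ⟨M', h⟩⟩

end Matching

/-! ## Runs of the algorithm -/

section Run

variable {C : Type u} {D : Digraph C} {s t : C} {f : {a : C // a ≠ t} → C}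

/-- The internal vertices of `T(f)` are the values of `f` on `C ∖ {s, t}`. -/
theorem internalVertices_attachmentTree (hD : WellFounded (fun b a => D.Adj a b))
    (hs : ∀ b, D.Adj s b ↔ b = t) (hf : ∀ a, D.Adj a.1 (f a)) :
    internalVertices (attachmentTree f) =
      Set.range fun a : {a : C // a ≠ s ∧ a ≠ t} => f ⟨a.1, a.2.2⟩ := by
  have hst : s ≠ t := by
    rintro rfl
    exact hD.irrefl.irrefl s ((hs s).2 rfl)
  have hfs : f ⟨s, hst⟩ = t := (hs _).1 (hf ⟨s, hst⟩)
  have hne : ∀ a, a.1 ≠ f a := fun a h => hD.irrefl.irrefl a.1 (by simpa [← h] using hf a)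
  ext c
  change ¬ ((attachmentTree f).neighborSet c).ncard = 1 ↔ _
  by_cases hct : c = t
  -- All neighbours of the sink are preimages under `f`, and `s` is one of them. The degree is one
  -- exactly if there is no other.
  · subst hct
    have hmem : s ∈ (attachmentTree f).neighborSet c :=
      attachmentTree_adj.2 ⟨hst.symm, Or.inr ⟨hst, hfs⟩⟩
    constructor
    · intro h
      by_contra hr
      refine h (Set.ncard_eq_one.2 ⟨s, Set.eq_singleton_iff_unique_mem.2 ⟨hmem, fun y hy => ?_⟩⟩)
      obtain ⟨-, ⟨h', -⟩ | ⟨h', hy⟩⟩ := attachmentTree_adj.1 hy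
      · exact absurd rfl h'
      · by_contra hys
        exact hr ⟨⟨y, hys, h'⟩, hy⟩
    · rintro ⟨⟨a, has, hac⟩, hfa⟩ h
      obtain ⟨x, hx⟩ := Set.ncard_eq_one.1 h
      have ha : a ∈ (attachmentTree f).neighborSet c :=
        attachmentTree_adj.2 ⟨hac.symm, Or.inr ⟨hac, hfa⟩⟩
      rw [hx] at hmem ha
      exact has (ha.trans hmem.symm)
  -- For `c ≠ t`, the vertex `f(c)` is a neighbour and the others are preimages of `c`; none of
  -- these is `s`, because `f(s) = t`.
  · have hmem : f ⟨c, hct⟩ ∈ (attachmentTree f).neighborSet c :=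
      attachmentTree_adj.2 ⟨hne ⟨c, hct⟩, Or.inl ⟨hct, rfl⟩⟩
    constructor
    · intro h
      by_contra hr
      refine h (Set.ncard_eq_one.2 ⟨_, Set.eq_singleton_iff_unique_mem.2 ⟨hmem, fun y hy => ?_⟩⟩)
      obtain ⟨-, ⟨h', hy⟩ | ⟨h', hy⟩⟩ := attachmentTree_adj.1 hy
      · exact hy.symm
      · by_cases hys : y = s
        · subst hys
          exact absurd (hy.symm.trans hfs) hct
        · exact absurd ⟨⟨y, hys, h'⟩, hy⟩ hr
    · rintro ⟨⟨a, has, hat⟩, hac⟩ h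
      obtain ⟨x, hx⟩ := Set.ncard_eq_one.1 h
      replace hac : f ⟨a, hat⟩ = c := hac
      have hadj : D.Adj a c := hac ▸ hf ⟨a, hat⟩
      have ha : a ∈ (attachmentTree f).neighborSet c :=
        attachmentTree_adj.2 ⟨fun h => hne ⟨a, hat⟩ (h.symm.trans hac.symm), Or.inr ⟨hat, hac⟩⟩
      rw [hx] at hmem ha
      -- If a preimage `a` coincided with `f(c)`, there would be arcs in both directions between `a`
      -- and `c`.
      have : f ⟨c, hct⟩ = a := hmem.trans ha.symm
      exact hD.asymmetric _ _ hadj (this ▸ hf ⟨c, hct⟩)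

variable {N : Type v} {P : Profile C N} {M : (matchingGraph D s t).Subgraph}

theorem IsRun.adj (h : IsRun P D s t M f) (a : {a : C // a ≠ t}) : D.Adj a.1 (f a) := by
  obtain ⟨a, hat⟩ := a
  by_cases has : a = s
  · subst has
    rw [h.start hat]
    exact (h.arc t).2 rfl
  · by_cases hv : Sum.inl ⟨a, has, hat⟩ ∈ M.verts
    · obtain ⟨w, hw, -⟩ := h.matching.1 hv
      obtain ⟨c, rfl⟩ := matchingGraph_adj_inl hw.adj_sub
      rw [h.matched a ⟨has, hat⟩ c hw]
      exact matchingGraph_adj.1 hw.adj_sub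
    · exact h.unmatched a ⟨has, hat⟩ hv

theorem exists_isRun [Finite C] [Nonempty N] (hC : 3 ≤ Nat.card C)
    (hD : P.IsAttachmentDigraph D) :
    ∃ (s t : C) (M : (matchingGraph D s t).Subgraph) (f : {a : C // a ≠ t} → C),
      IsRun P D s t M f := by
  have : Nonempty C := (Nat.card_pos_iff.1 (by omega)).1
  obtain ⟨t, ht⟩ := hD.exists_sink
  obtain ⟨s, hs⟩ := hD.exists_source trivial ht (by rw [Set.ncard_univ]; omega)
  obtain ⟨M, hM⟩ := exists_isMaximumMatching D s t
  have key : ∀ a : {a : C // a ≠ t}, ∃ c, D.Adj a c ∧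
      ∀ (ha : a.1 ≠ s ∧ a.1 ≠ t) (c' : C), M.Adj (Sum.inl ⟨a, ha⟩) (Sum.inr c') → c = c' := by
    rintro ⟨a, hat⟩
    by_cases hm : ∃ (ha : a ≠ s ∧ a ≠ t) (c' : C), M.Adj (Sum.inl ⟨a, ha⟩) (Sum.inr c')
    · obtain ⟨ha, c, hc⟩ := hm
      refine ⟨c, matchingGraph_adj.1 hc.adj_sub, fun _ c' hc' => ?_⟩
      exact Sum.inr_injective (hM.1.eq_of_adj_left hc hc')
    · obtain ⟨c, hc⟩ := Profile.Builds.exists_adj hD ht hat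
      exact ⟨c, hc, fun ha c' hc' => absurd ⟨ha, c', hc'⟩ hm⟩
  choose f hf hfM using key
  exact ⟨s, t, M, f, hD, ht, hs, hM, fun h => (hs _).1 (hf ⟨s, h⟩),
    fun a ha c h => hfM ⟨a, ha.2⟩ ha c h, fun a ha _ => hf ⟨a, ha.2⟩⟩

theorem ncard_leaves_add_ncard_internalVertices [Finite C] (T : SimpleGraph C) :
    (leaves T).ncard + (internalVertices T).ncard = Nat.card C :=
  Set.ncard_add_ncard_compl _

theorem IsRun.attachmentTree_mem_trees [Finite C] [Nonempty N] (h : IsRun P D s t M f) :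
    attachmentTree f ∈ P.trees := by
  have hT := attachmentTree_isTree h.digraph.wellFounded h.adj
  refine ⟨hT, Profile.LocallySinglePeaked.singlePeakedOn hT.isAcyclic
    (h.digraph.locallySinglePeaked fun a b hab => ?_)⟩
  have hat : a ≠ t := fun hat => h.sink b (hat ▸ hab)
  exact ⟨_, h.adj ⟨a, hat⟩,
    attachmentTree_adj.2 ⟨h.digraph.ne (h.adj ⟨a, hat⟩), Or.inl ⟨hat, rfl⟩⟩⟩

/-- All matched right vertices are values of `f`, and by maximality no function along arcs has more
values than `M` has edges. -/
theorem IsRun.ncard_internalVertices [Finite C] [Nonempty N] (h : IsRun P D s t M f) :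
    (internalVertices (attachmentTree f)).ncard = M.edgeSet.ncard := by
  rw [internalVertices_attachmentTree h.digraph.wellFounded h.arc h.adj]
  refine le_antisymm (h.matching.ncard_range_le fun a => h.adj ⟨a.1, a.2.2⟩) ?_
  rw [ncard_edgeSet_eq h.matching.1]
  refine Set.ncard_le_ncard ?_
  rintro c ⟨a, ha⟩
  exact ⟨a, h.matched a.1 a.2 c ha⟩

/-- The tree `T` contains some `T(g)` with `g` along arcs. Since `T(g)` is connected and trees are
minimally connected, they are equal, and the internal vertices of `T(g)` are bounded by the
matching. -/
theorem IsRun.ncard_leaves_le [Finite C] [Nonempty N] (h : IsRun P D s t M f)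
    {T : SimpleGraph C} (hT : T ∈ P.trees) :
    (leaves (attachmentTree f)).ncard ≤ (leaves T).ncard := by
  have hloc := hT.2.locallySinglePeaked hT.1.connected
  have hex : ∀ a : {a : C // a ≠ t}, ∃ c, D.Adj a.1 c ∧ T.Adj a.1 c := fun a => by
    obtain ⟨b, hb⟩ := Profile.Builds.exists_adj h.digraph h.sink a.2
    exact hloc.exists_adj_adj hT.1.isAcyclic h.digraph hb
  choose g hgD hgT using hex
  have hle : attachmentTree g ≤ T := by
    intro x y hxy
    obtain ⟨-, ⟨hx, rfl⟩ | ⟨hy, rfl⟩⟩ := attachmentTree_adj.1 hxy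
    exacts [hgT ⟨x, hx⟩, (hgT ⟨y, hy⟩).symm]
  have hg := attachmentTree_isTree h.digraph.wellFounded hgD
  have heq : attachmentTree g = T :=
    le_antisymm hle ((SimpleGraph.isTree_iff_minimal_connected.1 hT.1).2 hg.connected hle)
  have h1 := ncard_leaves_add_ncard_internalVertices (attachmentTree f)
  have h2 := ncard_leaves_add_ncard_internalVertices (attachmentTree g)
  have h3 : (internalVertices (attachmentTree g)).ncard ≤ M.edgeSet.ncard := by
    rw [internalVertices_attachmentTree h.digraph.wellFounded h.arc hgD]
    exact h.matching.ncard_range_le fun a => hgD ⟨a.1, a.2.2⟩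
  rw [h.ncard_internalVertices] at h1
  rw [← heq]
  omega

end Run

/-! ## A language of bounded loops

Statements of this language have a functional semantics and a compilation to programs of the random
access machine that run in polynomial time. The variables are kept in array `18` and the
truth values of formulas in array `19` of the machine. -/

namespace RAM

/-- Terms: constants, variables, array entries, sums. -/
inductive Tm
  | const (k : ℕ)
  | var (k : ℕ)
  | entry (x : ℕ) (i j : Tm)
  | add (a b : Tm)

namespace Tm

/-- The value of a term, for the values `e` of the variables. -/
def eval (e : ℕ → ℕ) (σ : Store) : Tm → ℕ
  | const k => k
  | var k => e k
  | entry x i j => σ x (i.eval e σ) (j.eval e σ)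
  | add a b => a.eval e σ + b.eval e σ

/-- The translation of terms to expressions. -/
def expr : Tm → Expr
  | const k => .const k
  | var k => .entry 18 (.const k) (.const 0)
  | entry x i j => .entry x i.expr j.expr
  | add a b => .plus a.expr b.expr

/-- The variables of a term are among the first `l`, and it uses no auxiliary array. -/
def wf (l : ℕ) : Tm → Bool
  | const _ => true
  | var k => decide (k < l)
  | entry x i j => decide (x < 18) && i.wf l && j.wf l
  | add a b => a.wf l && b.wf l

end Tm

/-- The machine memory `σ'` represents the memory `σ` and the values `e` of the first `l`
variables. -/
structure Agree (l : ℕ) (e : ℕ → ℕ) (σ σ' : Store) : Prop where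
  store : ∀ x < 18, σ' x = σ x
  vars : ∀ k < l, σ' 18 k 0 = e k

theorem Store.write_of_ne {σ : Store} {x i j v y : ℕ} (h : y ≠ x) : σ.write x i j v y = σ y := by
  funext a b
  simp [Store.write, h]

theorem Store.write_self {σ : Store} {x i j v : ℕ} : σ.write x i j v x i j = v := by
  simp [Store.write]

theorem Agree.write_flag {l : ℕ} {e : ℕ → ℕ} {σ σ' : Store} (h : Agree l e σ σ') (i j v : ℕ) :
    Agree l e σ (σ'.write 19 i j v) :=
  ⟨fun x hx => by rw [Store.write_of_ne (by omega), h.store x hx],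
    fun k hk => by rw [Store.write_of_ne (by omega), h.vars k hk]⟩

theorem Agree.write_var {l : ℕ} {e : ℕ → ℕ} {σ σ' : Store} (h : Agree l e σ σ') (v : ℕ) :
    Agree (l + 1) (Function.update e l v) σ (σ'.write 18 l 0 v) := by
  refine ⟨fun x hx => by rw [Store.write_of_ne (by omega), h.store x hx], fun k hk => ?_⟩
  by_cases hkl : k = l
  · subst hkl
    simp [Store.write_self]
  · simp [Store.write, hkl, h.vars k (by omega)]

theorem Agree.of_succ {l v : ℕ} {e : ℕ → ℕ} {σ σ' : Store}
    (h : Agree (l + 1) (Function.update e l v) σ σ') : Agree l e σ σ' :=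
  ⟨h.store, fun k hk => by rw [h.vars k (by omega), Function.update_of_ne (by omega)]⟩

theorem Agree.write_store {l x : ℕ} {e : ℕ → ℕ} {σ σ' : Store} (h : Agree l e σ σ') (hx : x < 18)
    (i j v : ℕ) : Agree l e (σ.write x i j v) (σ'.write x i j v) := by
  refine ⟨fun y hy => ?_, fun k hk => by rw [Store.write_of_ne (by omega), h.vars k hk]⟩
  funext a b
  simp [Store.write, h.store y hy]

theorem Tm.eval_expr {l : ℕ} {e : ℕ → ℕ} {σ σ' : Store} (h : Agree l e σ σ') (t : Tm)
    (ht : t.wf l) : t.expr.eval σ' = t.eval e σ := by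
  induction t with
  | const k => rfl
  | var k => exact h.vars k (by simpa [wf] using ht)
  | entry x i j ihi ihj =>
    simp only [wf, Bool.and_eq_true, decide_eq_true_eq] at ht
    simp only [expr, Expr.eval, eval, ihi ht.1.2, ihj ht.2, h.store x ht.1.1]
  | add a b iha ihb =>
    simp only [wf, Bool.and_eq_true] at ht
    simp only [expr, Expr.eval, eval, iha ht.1, ihb ht.2]

/-- A loop with a counter. -/
theorem exists_runs_loop {c : Expr} {p : Program} {B K : ℕ} (I : ℕ → Store → Prop)
    (hc : ∀ x τ, x ≤ B → I x τ → c.eval τ = if x < B then 1 else 0)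
    (hp : ∀ x τ, x < B → I x τ → ∃ k τ', Runs p τ k τ' ∧ k ≤ K ∧ I (x + 1) τ') {σ : Store}
    (hσ : I 0 σ) :
    ∃ k τ, Runs (.loop c p) σ k τ ∧ k ≤ B * (c.cost + 1 + K) + (c.cost + 1) ∧ I B τ := by
  have key : ∀ n x τ, x + n = B → I x τ →
      ∃ k τ', Runs (.loop c p) τ k τ' ∧ k ≤ n * (c.cost + 1 + K) + (c.cost + 1) ∧ I B τ' := by
    intro n
    induction n with
    | zero =>
      intro x τ hx hI
      have h0 : c.eval τ = 0 := by rw [hc x τ (by omega) hI, if_neg (by omega)]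
      refine ⟨_, τ, Runs.loop_stop h0, by omega, ?_⟩
      rwa [show B = x by omega]
    | succ n ih =>
      intro x τ hx hI
      obtain ⟨k, τ', hr, hk, hI'⟩ := hp x τ (by omega) hI
      obtain ⟨k', τ'', hr', hk', hI''⟩ := ih (x + 1) τ' (by omega) hI'
      refine ⟨_, τ'', .loop_step ?_ hr hr', ?_, hI''⟩
      · rw [hc x τ (by omega) hI, if_pos (by omega)]
        exact one_ne_zero
      · rw [Nat.succ_mul]
        omega
  exact key B 0 σ (by omega) hσ

/-- Formulas with quantifiers over the numbers that are less than a scalar. -/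
inductive Form
  | eq (a b : Tm)
  | lt (a b : Tm)
  | neg (φ : Form)
  | and (φ ψ : Form)
  | all (x k : ℕ) (φ : Form)

namespace Form

/-- The truth of a formula. -/
def Holds (e : ℕ → ℕ) (σ : Store) : Form → Prop
  | eq a b => a.eval e σ = b.eval e σ
  | lt a b => a.eval e σ < b.eval e σ
  | neg φ => ¬ φ.Holds e σ
  | and φ ψ => φ.Holds e σ ∧ ψ.Holds e σ
  | all x k φ => ∀ v < σ x 0 0, φ.Holds (Function.update e k v) σ

/-- The disjunction of two formulas. -/
def or (φ ψ : Form) : Form := neg (and (neg φ) (neg ψ))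

/-- Existential quantification. -/
def ex (x k : ℕ) (φ : Form) : Form := neg (all x k (neg φ))

theorem holds_or {e : ℕ → ℕ} {σ : Store} {φ ψ : Form} :
    (φ.or ψ).Holds e σ ↔ φ.Holds e σ ∨ ψ.Holds e σ := by
  simp only [or, Holds]
  tauto

theorem holds_ex {e : ℕ → ℕ} {σ : Store} {x k : ℕ} {φ : Form} :
    (φ.ex x k).Holds e σ ↔ ∃ v < σ x 0 0, φ.Holds (Function.update e k v) σ := by
  simp only [ex, Holds]
  push Not
  rfl

/-- Quantified variables are numbered by their depth, and quantifiers range over the numbers less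
than one of the two input sizes. -/
def wf (l : ℕ) : Form → Bool
  | eq a b => a.wf l && b.wf l
  | lt a b => a.wf l && b.wf l
  | neg φ => φ.wf l
  | and φ ψ => φ.wf l && ψ.wf l
  | all x k φ => decide (x = 1 ∨ x = 2) && decide (k = l) && φ.wf (l + 1)

/-- A program that computes the truth value of a formula. -/
def prog (l : ℕ) : Form → Program
  | eq a b => .assign 19 (.const l) (.const 0) (.equal a.expr b.expr)
  | lt a b => .assign 19 (.const l) (.const 0) (.less a.expr b.expr)
  | neg φ => .seq (φ.prog l) (.assign 19 (.const l) (.const 0)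
      (.equal (.entry 19 (.const l) (.const 0)) (.const 0)))
  | and φ ψ => .seq (φ.prog l) (.branch (.entry 19 (.const l) (.const 0)) (ψ.prog l) .skip)
  | all x k φ => .seq (.assign 19 (.const l) (.const 0) (.const 1))
      (.seq (.assign 18 (.const k) (.const 0) (.const 0))
        (.loop (.less (.entry 18 (.const k) (.const 0)) (.entry x (.const 0) (.const 0)))
          (.seq (φ.prog (l + 1))
            (.seq (.branch (.entry 19 (.const (l + 1)) (.const 0)) .skip
                (.assign 19 (.const l) (.const 0) (.const 0)))
              (.assign 18 (.const k) (.const 0)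
                (.plus (.entry 18 (.const k) (.const 0)) (.const 1)))))))

open Classical in
/-- Correctness of the evaluation of formulas. -/
theorem exists_runs_prog (φ : Form) (l : ℕ) (hφ : φ.wf l) : ∃ q : Polynomial ℕ,
    ∀ (N : ℕ) (e : ℕ → ℕ) (σ σ' : Store), σ 1 0 0 ≤ N → σ 2 0 0 ≤ N → Agree l e σ σ' →
      ∃ k τ, Runs (φ.prog l) σ' k τ ∧ k ≤ q.eval N ∧ Agree l e σ τ ∧
        (∀ j < l, τ 19 j 0 = σ' 19 j 0) ∧ τ 19 l 0 = if φ.Holds e σ then 1 else 0 := by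
  induction φ generalizing l with
  | eq a b =>
    simp only [wf, Bool.and_eq_true] at hφ
    refine ⟨.C (a.expr.cost + b.expr.cost + 5), fun N e σ σ' h1 h2 h =>
      ⟨_, _, .assign _ _ _ _ _, ?_, h.write_flag _ _ _, ?_, ?_⟩⟩
    · simp only [Expr.cost, Polynomial.eval_C]
      omega
    · intro j hj
      simp [Store.write, Expr.eval, hj.ne]
    · simp only [Expr.eval, Store.write_self, a.eval_expr h hφ.1, b.eval_expr h hφ.2, Holds]
      congr
  | lt a b =>
    simp only [wf, Bool.and_eq_true] at hφ
    refine ⟨.C (a.expr.cost + b.expr.cost + 5), fun N e σ σ' h1 h2 h =>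
      ⟨_, _, .assign _ _ _ _ _, ?_, h.write_flag _ _ _, ?_, ?_⟩⟩
    · simp only [Expr.cost, Polynomial.eval_C]
      omega
    · intro j hj
      simp [Store.write, Expr.eval, hj.ne]
    · simp only [Expr.eval, Store.write_self, a.eval_expr h hφ.1, b.eval_expr h hφ.2, Holds]
      congr
  | neg φ ih =>
    obtain ⟨q, hq⟩ := ih l hφ
    refine ⟨q + .C 10, fun N e σ σ' h1 h2 h => ?_⟩
    obtain ⟨k, τ, hr, hk, hag, hfl, hv⟩ := hq N e σ σ' h1 h2 h
    refine ⟨_, _, .seq hr (.assign _ _ _ _ _), ?_, hag.write_flag _ _ _, ?_, ?_⟩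
    · simp only [Expr.cost, Polynomial.eval_C, Polynomial.eval_add]
      omega
    · intro j hj
      simp [Store.write, Expr.eval, hj.ne, hfl j hj]
    · simp only [Expr.eval, Store.write_self, hv, Holds]
      by_cases hh : φ.Holds e σ <;> simp [hh]
  | and φ ψ ihφ ihψ =>
    simp only [wf, Bool.and_eq_true] at hφ
    obtain ⟨q, hq⟩ := ihφ l hφ.1
    obtain ⟨q', hq'⟩ := ihψ l hφ.2
    refine ⟨q + q' + .C 10, fun N e σ σ' h1 h2 h => ?_⟩
    obtain ⟨k, τ, hr, hk, hag, hfl, hv⟩ := hq N e σ σ' h1 h2 h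
    simp only [Polynomial.eval_C, Polynomial.eval_add]
    by_cases hh : φ.Holds e σ
    · obtain ⟨k', τ', hr', hk', hag', hfl', hv'⟩ := hq' N e σ τ h1 h2 hag
      refine ⟨_, τ', .seq hr (.branch_true ?_ hr'), ?_, hag', ?_, ?_⟩
      · simp [Expr.eval, hv, hh]
      · simp only [Expr.cost]
        omega
      · intro j hj
        rw [hfl' j hj, hfl j hj]
      · simp [hv', Holds, hh]
    · refine ⟨_, τ, .seq hr (.branch_false ?_ (.skip _)), ?_, hag, hfl, ?_⟩
      · simp [Expr.eval, hv, hh]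
      · simp only [Expr.cost]
        omega
      · simp [hv, Holds, hh]
  | all x k φ ih =>
    simp only [wf, Bool.and_eq_true, decide_eq_true_eq] at hφ
    obtain ⟨⟨hx, rfl⟩, hφ⟩ := hφ
    obtain ⟨q, hq⟩ := ih (k + 1) hφ
    -- Testing the loop condition costs `8` steps. The inner `20` is a generous bound for updating
    -- flag and counter, the outer one for the initialization and the last test.
    refine ⟨.X * (.C 8 + (q + .C 20)) + .C 20, fun N e σ σ' h1 h2 h => ?_⟩
    let c : Expr := .less (.entry 18 (.const k) (.const 0)) (.entry x (.const 0) (.const 0))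
    -- After `n` iterations the counter is `n`, and flag `k` tells whether the first `n` instances
    -- hold. The body is evaluated at level `k + 1` and preserves all flags of smaller level, so
    -- flag `k` survives.
    let I : ℕ → Store → Prop := fun n τ => Agree (k + 1) (Function.update e k n) σ τ ∧
      (∀ j < k, τ 19 j 0 = σ' 19 j 0) ∧
      τ 19 k 0 = if ∀ v < n, φ.Holds (Function.update e k v) σ then 1 else 0
    have hbound : σ x 0 0 ≤ N := by rcases hx with rfl | rfl <;> assumption
    have hcond : ∀ n τ, n ≤ σ x 0 0 → I n τ → c.eval τ = if n < σ x 0 0 then 1 else 0 := by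
      intro n τ _ hI
      simp [c, Expr.eval, hI.1.vars k (by omega), hI.1.store x (by omega)]
    have h0 := (h.write_flag k 0 1).write_var 0
    obtain ⟨K, τ, hr, hK, hI⟩ := exists_runs_loop (c := c) (B := σ x 0 0) (K := q.eval N + 20)
      (p := .seq (φ.prog (k + 1))
            (.seq (.branch (.entry 19 (.const (k + 1)) (.const 0)) .skip
                (.assign 19 (.const k) (.const 0) (.const 0)))
              (.assign 18 (.const k) (.const 0)
                (.plus (.entry 18 (.const k) (.const 0)) (.const 1))))) I hcond (by
        intro n τ hn hI
        obtain ⟨K, τ', hr, hK, hag, hfl, hv⟩ := hq N _ σ τ h1 h2 hI.1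
        by_cases hh : φ.Holds (Function.update e k n) σ
        · refine ⟨_, _, .seq hr (.seq (.branch_true ?_ (.skip _)) (.assign _ _ _ _ _)), ?_,
            ?_, ?_, ?_⟩
          · simp [Expr.eval, hv, hh]
          · simp only [Expr.cost]
            omega
          · simpa [Expr.eval, hag.vars k (by omega)] using hag.of_succ.write_var (n + 1)
          · intro j hj
            rw [Store.write_of_ne (by omega), hfl j (by omega), hI.2.1 j hj]
          · rw [Store.write_of_ne (by omega), hfl k (by omega), hI.2.2]
            have : (∀ v < n + 1, φ.Holds (Function.update e k v) σ) ↔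
                ∀ v < n, φ.Holds (Function.update e k v) σ := by
              rw [Nat.forall_lt_succ_right, and_iff_left hh]
            exact if_congr this.symm rfl rfl
        · refine ⟨_, _, .seq hr (.seq (.branch_false ?_ (.assign _ _ _ _ _))
            (.assign _ _ _ _ _)), ?_, ?_, ?_, ?_⟩
          · simp [Expr.eval, hv, hh]
          · simp only [Expr.cost]
            omega
          · have := (hag.of_succ.write_flag k 0 0).write_var (n + 1)
            simpa [Expr.eval, hag.vars k (by omega), Store.write_of_ne] using this
          · intro j hj
            rw [Store.write_of_ne (by omega)]
            simp [Store.write, Expr.eval, hj.ne, hfl j (by omega), hI.2.1 j hj]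
          · rw [Store.write_of_ne (by omega)]
            simp only [Expr.eval, Store.write_self]
            rw [if_neg]
            exact fun h => hh (h n (by omega)))
      (σ := (σ'.write 19 k 0 1).write 18 k 0 0) ⟨h0, fun j hj => by simp [Store.write, hj.ne], by
        simp [Store.write]⟩
    refine ⟨_, τ, .seq (.assign _ _ _ _ _) (.seq (.assign _ _ _ _ _) hr), ?_,
      hI.1.of_succ, hI.2.1, by
        convert hI.2.2
        exact Iff.rfl⟩
    have h3 := hK.trans (Nat.add_le_add_right (Nat.mul_le_mul_right _ hbound) _)
    simp only [c, Expr.cost] at h3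
    simp only [Expr.cost, Polynomial.eval_C, Polynomial.eval_add, Polynomial.eval_mul,
      Polynomial.eval_X]
    have h4 : N * (1 + 1 + 1 + (1 + 1 + 1) + 1 + 1 + (q.eval N + 20)) =
      N * (8 + (q.eval N + 20)) := by ring
    omega

end Form

/-- Statements. -/
inductive Stmt
  | assign (x : ℕ) (i j t : Tm)
  | seq (s s' : Stmt)
  | cond (φ : Form) (s : Stmt)
  | loop (k : ℕ) (s : Stmt)

namespace Stmt

open Classical in
/-- The memory after the execution of a statement. Loops run over the numbers that are less than
the scalar `1`. -/
noncomputable def den : Stmt → (ℕ → ℕ) → Store → Store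
  | assign x i j t, e, σ => σ.write x (i.eval e σ) (j.eval e σ) (t.eval e σ)
  | seq s s', e, σ => s'.den e (s.den e σ)
  | cond φ s, e, σ => if φ.Holds e σ then s.den e σ else σ
  | loop k s, e, σ => Nat.rec σ (fun n τ => s.den (Function.update e k n) τ) (σ 1 0 0)

/-- Loop variables are numbered by their depth, and only the arrays `3`, …, `17` are changed. -/
def wf (l : ℕ) : Stmt → Bool
  | assign x i j t => decide (3 ≤ x ∧ x < 18) && i.wf l && j.wf l && t.wf l
  | seq s s' => s.wf l && s'.wf l
  | cond φ s => φ.wf l && s.wf l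
  | loop k s => decide (k = l) && s.wf (l + 1)

/-- The translation of statements to programs. -/
def prog (l : ℕ) : Stmt → Program
  | assign x i j t => .assign x i.expr j.expr t.expr
  | seq s s' => .seq (s.prog l) (s'.prog l)
  | cond φ s => .seq (φ.prog l) (.branch (.entry 19 (.const l) (.const 0)) (s.prog l) .skip)
  | loop k s => .seq (.assign 18 (.const k) (.const 0) (.const 0))
      (.loop (.less (.entry 18 (.const k) (.const 0)) (.entry 1 (.const 0) (.const 0)))
        (.seq (s.prog (l + 1)) (.assign 18 (.const k) (.const 0)
          (.plus (.entry 18 (.const k) (.const 0)) (.const 1)))))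

/-- In `den` the number of iterations is fixed at the start, while the machine compares the counter
with scalar `1` in every iteration. The two agree because the sizes are never overwritten. This also
keeps the bound `N` valid for subsequent statements. -/
theorem den_of_lt (s : Stmt) {l : ℕ} (hs : s.wf l) {x : ℕ} (hx : x < 3) (e : ℕ → ℕ) (σ : Store) :
    s.den e σ x = σ x := by
  induction s generalizing l e σ with
  | assign y i j t =>
    simp only [wf, Bool.and_eq_true, decide_eq_true_eq] at hs
    exact Store.write_of_ne (by omega)
  | seq s s' ih ih' =>
    simp only [wf, Bool.and_eq_true] at hs
    rw [den, ih' hs.2, ih hs.1]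
  | cond φ s ih =>
    simp only [wf, Bool.and_eq_true] at hs
    rw [den]
    split_ifs
    exacts [ih hs.2 e σ, rfl]
  | loop k s ih =>
    simp only [wf, Bool.and_eq_true] at hs
    rw [den]
    induction σ 1 0 0 with
    | zero => rfl
    | succ n ihn => exact (ih hs.2 _ _).trans ihn

/-- Correctness of the translation, with a polynomial bound on the running time. -/
theorem exists_runs_prog (s : Stmt) (l : ℕ) (hs : s.wf l) : ∃ q : Polynomial ℕ,
    ∀ (N : ℕ) (e : ℕ → ℕ) (σ σ' : Store), σ 1 0 0 ≤ N → σ 2 0 0 ≤ N → Agree l e σ σ' →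
      ∃ k τ, Runs (s.prog l) σ' k τ ∧ k ≤ q.eval N ∧ Agree l e (s.den e σ) τ := by
  induction s generalizing l with
  | assign x i j t =>
    simp only [wf, Bool.and_eq_true, decide_eq_true_eq] at hs
    refine ⟨.C (i.expr.cost + j.expr.cost + t.expr.cost + 1), fun N e σ σ' h1 h2 h =>
      ⟨_, _, .assign _ _ _ _ _, by simp, ?_⟩⟩
    rw [i.eval_expr h hs.1.1.2, j.eval_expr h hs.1.2, t.eval_expr h hs.2]
    exact h.write_store hs.1.1.1.2 _ _ _
  | seq s s' ih ih' =>
    simp only [wf, Bool.and_eq_true] at hs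
    obtain ⟨q, hq⟩ := ih l hs.1
    obtain ⟨q', hq'⟩ := ih' l hs.2
    refine ⟨q + q', fun N e σ σ' h1 h2 h => ?_⟩
    obtain ⟨k, τ, hr, hk, hag⟩ := hq N e σ σ' h1 h2 h
    obtain ⟨k', τ', hr', hk', hag'⟩ := hq' N e _ τ (by rwa [s.den_of_lt hs.1 (by omega)])
      (by rwa [s.den_of_lt hs.1 (by omega)]) hag
    exact ⟨_, τ', .seq hr hr', by rw [Polynomial.eval_add]; omega, hag'⟩
  | cond φ s ih =>
    simp only [wf, Bool.and_eq_true] at hs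
    obtain ⟨q, hq⟩ := φ.exists_runs_prog l hs.1
    obtain ⟨q', hq'⟩ := ih l hs.2
    refine ⟨q + q' + .C 10, fun N e σ σ' h1 h2 h => ?_⟩
    obtain ⟨k, τ, hr, hk, hag, -, hv⟩ := hq N e σ σ' h1 h2 h
    simp only [Polynomial.eval_C, Polynomial.eval_add, den]
    by_cases hh : φ.Holds e σ
    · obtain ⟨k', τ', hr', hk', hag'⟩ := hq' N e σ τ h1 h2 hag
      refine ⟨_, τ', .seq hr (.branch_true ?_ hr'), ?_, by rwa [if_pos hh]⟩
      · simp [Expr.eval, hv, hh]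
      · simp only [Expr.cost]
        omega
    · refine ⟨_, τ, .seq hr (.branch_false ?_ (.skip _)), ?_, by rwa [if_neg hh]⟩
      · simp [Expr.eval, hv, hh]
      · simp only [Expr.cost]
        omega
  | loop k s ih =>
    simp only [wf, Bool.and_eq_true, decide_eq_true_eq] at hs
    obtain ⟨rfl, hs⟩ := hs
    obtain ⟨q, hq⟩ := ih (k + 1) hs
    refine ⟨.X * (.C 8 + (q + .C 10)) + .C 20, fun N e σ σ' h1 h2 h => ?_⟩
    let c : Expr := .less (.entry 18 (.const k) (.const 0)) (.entry 1 (.const 0) (.const 0))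
    let d : ℕ → Store := fun n => Nat.rec σ (fun n τ => s.den (Function.update e k n) τ) n
    have hd : ∀ n, ∀ x < 3, d n x = σ x := by
      intro n x hx
      induction n with
      | zero => rfl
      | succ n ihn => exact (s.den_of_lt hs hx _ _).trans ihn
    obtain ⟨K, τ, hr, hK, hI⟩ := exists_runs_loop (c := c) (B := σ 1 0 0) (K := q.eval N + 10)
      (p := .seq (s.prog (k + 1)) (.assign 18 (.const k) (.const 0)
          (.plus (.entry 18 (.const k) (.const 0)) (.const 1))))
      (fun n τ => Agree (k + 1) (Function.update e k n) (d n) τ) (by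
        intro n τ _ hI
        simp [c, Expr.eval, hI.vars k (by omega), hI.store 1 (by omega), hd n 1 (by omega)]) (by
        intro n τ hn hI
        obtain ⟨K, τ', hr, hK, hag⟩ := hq N _ (d n) τ (by rwa [hd n 1 (by omega)])
          (by rwa [hd n 2 (by omega)]) hI
        refine ⟨_, _, .seq hr (.assign _ _ _ _ _), ?_, ?_⟩
        · simp only [Expr.cost]
          omega
        · have := hag.of_succ.write_var (n + 1)
          simpa [Expr.eval, hag.vars k (by omega)] using this)
      (σ := σ'.write 18 k 0 0) (h.write_var 0)
    refine ⟨_, τ, .seq (.assign _ _ _ _ _) hr, ?_, hI.of_succ⟩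
    have h3 := hK.trans (Nat.add_le_add_right (Nat.mul_le_mul_right _ h1) _)
    simp only [c, Expr.cost] at h3
    simp only [Expr.cost, Polynomial.eval_C, Polynomial.eval_add, Polynomial.eval_mul,
      Polynomial.eval_X]
    have h4 : N * (1 + 1 + 1 + (1 + 1 + 1) + 1 + 1 + (q.eval N + 10)) =
      N * (8 + (q.eval N + 10)) := by ring
    omega

end Stmt

end RAM

namespace RAM

/-! ## Definable updates -/

/-- A term does not read array `x`. -/
def Tm.avoids (x : ℕ) : Tm → Bool
  | const _ => true
  | var _ => true
  | entry y i j => decide (y ≠ x) && i.avoids x && j.avoids x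
  | add a b => a.avoids x && b.avoids x

/-- A formula does not read array `x`. -/
def Form.avoids (x : ℕ) : Form → Bool
  | eq a b => a.avoids x && b.avoids x
  | lt a b => a.avoids x && b.avoids x
  | neg φ => φ.avoids x
  | and φ ψ => φ.avoids x && ψ.avoids x
  | all y _ φ => decide (y ≠ x) && φ.avoids x

theorem Tm.eval_congr {x : ℕ} {σ τ : Store} (h : ∀ y, y ≠ x → τ y = σ y) (e : ℕ → ℕ) (t : Tm)
    (ht : t.avoids x) : t.eval e τ = t.eval e σ := by
  induction t with
  | const k => rfl
  | var k => rfl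
  | entry y i j ihi ihj =>
    simp only [avoids, Bool.and_eq_true, decide_eq_true_eq] at ht
    simp only [eval, ihi ht.1.2, ihj ht.2, h y ht.1.1]
  | add a b iha ihb =>
    simp only [avoids, Bool.and_eq_true] at ht
    simp only [eval, iha ht.1, ihb ht.2]

/-- Writing to an array that a formula avoids does not change its truth. A sweep that tests the
formula for all pairs can therefore be analysed in terms of the initial memory. -/
theorem Form.holds_congr {x : ℕ} {σ τ : Store} (h : ∀ y, y ≠ x → τ y = σ y) (φ : Form)
    (hφ : φ.avoids x) (e : ℕ → ℕ) : φ.Holds e τ ↔ φ.Holds e σ := by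
  induction φ generalizing e with
  | eq a b =>
    simp only [avoids, Bool.and_eq_true] at hφ
    simp only [Holds, a.eval_congr h e hφ.1, b.eval_congr h e hφ.2]
  | lt a b =>
    simp only [avoids, Bool.and_eq_true] at hφ
    simp only [Holds, a.eval_congr h e hφ.1, b.eval_congr h e hφ.2]
  | neg φ ih => simp only [Holds, ih hφ]
  | and φ ψ ih ih' =>
    simp only [avoids, Bool.and_eq_true] at hφ
    simp only [Holds, ih hφ.1, ih' hφ.2]
  | all y k φ ih =>
    simp only [avoids, Bool.and_eq_true, decide_eq_true_eq] at hφ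
    simp only [Holds, ih hφ.2, h y hφ.1]

namespace Stmt

/-- The rule for loops. -/
theorem den_loop_induction {k : ℕ} {s : Stmt} {e : ℕ → ℕ} {σ : Store} (I : ℕ → Store → Prop)
    (h0 : I 0 σ)
    (hs : ∀ n < σ 1 0 0, ∀ τ, I n τ → I (n + 1) (s.den (Function.update e k n) τ)) :
    I (σ 1 0 0) ((Stmt.loop k s).den e σ) := by
  have key : ∀ n ≤ σ 1 0 0,
      I n (Nat.rec σ (fun n τ => s.den (Function.update e k n) τ) n) := by
    intro n hn
    induction n with
    | zero => exact h0
    | succ n ih => exact hs n hn _ (ih (by omega))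
  exact key _ le_rfl

/-- Two nested loops over a conditional statement. -/
def forForCond (l : ℕ) (φ : Form) (s : Stmt) : Stmt :=
  .loop l (.loop (l + 1) (.cond φ s))

/-- The rule for two nested loops. -/
theorem den_forForCond_induction {l : ℕ} {φ : Form} {s : Stmt} {e : ℕ → ℕ} {σ : Store}
    (I : ℕ → ℕ → Store → Prop) (h1 : ∀ a b τ, I a b τ → τ 1 0 0 = σ 1 0 0) (h0 : I 0 0 σ)
    (hnext : ∀ a τ, I a (σ 1 0 0) τ → I (a + 1) 0 τ)
    (hstep : ∀ a < σ 1 0 0, ∀ b < σ 1 0 0, ∀ τ, I a b τ →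
      φ.Holds (Function.update (Function.update e l a) (l + 1) b) τ →
      I a (b + 1) (s.den (Function.update (Function.update e l a) (l + 1) b) τ))
    (hskip : ∀ a < σ 1 0 0, ∀ b < σ 1 0 0, ∀ τ, I a b τ →
      ¬ φ.Holds (Function.update (Function.update e l a) (l + 1) b) τ → I a (b + 1) τ) :
    I (σ 1 0 0) 0 ((forForCond l φ s).den e σ) := by
  refine den_loop_induction (fun a τ => I a 0 τ) h0 fun a ha τ hτ => hnext a _ ?_
  have hm := h1 a 0 τ hτ
  have := den_loop_induction (k := l + 1) (s := .cond φ s) (e := Function.update e l a) (σ := τ)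
    (fun b τ => I a b τ) hτ fun b hb τ' hτ' => by
      rw [hm] at hb
      rw [den]
      split_ifs with h
      exacts [hstep a ha b hb τ' hτ' h, hskip a ha b hb τ' hτ' h]
  rwa [hm] at this

/-- Add all pairs that satisfy a formula to the relation in array `x`. -/
def addRel (l x : ℕ) (φ : Form) : Stmt :=
  forForCond l φ (.assign x (.var l) (.var (l + 1)) (.const 1))

-- As `φ` avoids array `x`, earlier writes do not influence later tests, so the sweep acts as a
-- simultaneous update. The assumption `x ≠ 1` protects the loop bound.
open Classical in
theorem den_addRel {l x : ℕ} {φ : Form} (hx : x ≠ 1) (hφ : φ.avoids x) (e : ℕ → ℕ) (σ : Store) :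
    (addRel l x φ).den e σ = fun y i j =>
      if y = x ∧ (i < σ 1 0 0 ∧ j < σ 1 0 0) ∧
        φ.Holds (Function.update (Function.update e l i) (l + 1) j) σ then 1 else σ y i j := by
  -- The memory after the rows before `a` and the first `b` entries of row `a` have been treated.
  let st : ℕ → ℕ → Store := fun a b y i j =>
    if y = x ∧ ((i < a ∧ j < σ 1 0 0) ∨ (i = a ∧ j < b)) ∧
      φ.Holds (Function.update (Function.update e l i) (l + 1) j) σ then 1 else σ y i j
  have hst : ∀ a b y, y ≠ x → st a b y = σ y := fun a b y hy => by
    funext i j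
    simp [st, hy]
  have := den_forForCond_induction (l := l) (φ := φ) (e := e) (σ := σ)
    (s := .assign x (.var l) (.var (l + 1)) (.const 1)) (fun a b τ => τ = st a b)
    (by
      rintro a b _ rfl
      rw [hst a b 1 hx.symm])
    (by
      funext y i j
      simp [st])
    (by
      rintro a _ rfl
      funext y i j
      refine if_congr ?_ rfl rfl
      refine and_congr_right fun _ => and_congr_left fun _ => ?_
      omega)
    (by
      rintro a ha b hb _ rfl h
      rw [Form.holds_congr (hst a b) φ hφ] at h
      funext y i j
      have h1 : Function.update (Function.update e l a) (l + 1) b l = a := by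
        rw [Function.update_of_ne (by omega), Function.update_self]
      simp only [den, Tm.eval, h1, Function.update_self, Store.write, st]
      by_cases hh : y = x ∧ i = a ∧ j = b
      · obtain ⟨rfl, rfl, rfl⟩ := hh
        rw [if_pos ⟨rfl, rfl, rfl⟩, if_pos ⟨rfl, Or.inr ⟨rfl, by omega⟩, h⟩]
      · rw [if_neg hh]
        refine if_congr ?_ rfl rfl
        refine and_congr_right fun hy => and_congr_left fun _ => ?_
        have : ¬ (i = a ∧ j = b) := fun h => hh ⟨hy, h⟩
        omega)
    (by
      rintro a ha b hb _ rfl h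
      rw [Form.holds_congr (hst a b) φ hφ] at h
      funext y i j
      simp only [st]
      by_cases hh : i = a ∧ j = b
      · obtain ⟨rfl, rfl⟩ := hh
        rw [if_neg fun h' => h h'.2.2, if_neg fun h' => h h'.2.2]
      · refine if_congr ?_ rfl rfl
        refine and_congr_right fun hy => and_congr_left fun _ => ?_
        omega)
  refine Eq.trans this ?_
  funext y i j
  simp only [st]
  refine if_congr ?_ rfl rfl
  refine and_congr_right fun hy => and_congr_left fun _ => ?_
  omega

theorem den_addRel_of_ne {l x : ℕ} {φ : Form} (hx : x ≠ 1) (hφ : φ.avoids x) (e : ℕ → ℕ)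
    (σ : Store) {y : ℕ} (hy : y ≠ x) : (addRel l x φ).den e σ y = σ y := by
  rw [den_addRel hx hφ]
  funext i j
  simp [hy]

theorem den_addRel_eq_one_iff {l x : ℕ} {φ : Form} (hx : x ≠ 1) (hφ : φ.avoids x) (e : ℕ → ℕ)
    (σ : Store) {i j : ℕ} (hi : i < σ 1 0 0) (hj : j < σ 1 0 0) :
    (addRel l x φ).den e σ x i j = 1 ↔
      φ.Holds (Function.update (Function.update e l i) (l + 1) j) σ ∨ σ x i j = 1 := by
  rw [den_addRel hx hφ]
  dsimp only
  split_ifs with h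
  · simp [h.2.2]
  · have : ¬ φ.Holds (Function.update (Function.update e l i) (l + 1) j) σ :=
      fun h' => h ⟨rfl, ⟨hi, hj⟩, h'⟩
    simp only [this, false_or]

theorem den_addRel_eq_zero_iff {l x : ℕ} {φ : Form} (hx : x ≠ 1) (hφ : φ.avoids x) (e : ℕ → ℕ)
    (σ : Store) {i j : ℕ} (hi : i < σ 1 0 0) (hj : j < σ 1 0 0) :
    (addRel l x φ).den e σ x i j = 0 ↔
      ¬ φ.Holds (Function.update (Function.update e l i) (l + 1) j) σ ∧ σ x i j = 0 := by
  rw [den_addRel hx hφ]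
  dsimp only
  split_ifs with h
  · simp [h.2.2]
  · have : ¬ φ.Holds (Function.update (Function.update e l i) (l + 1) j) σ :=
      fun h' => h ⟨rfl, ⟨hi, hj⟩, h'⟩
    simp only [this, not_false_eq_true, true_and]

/-- For each `a`, write some `c` such that `(a, c)` satisfies a formula to entry `(a, 0)` of
array `x`. -/
def choose (l x : ℕ) (φ : Form) : Stmt :=
  forForCond l φ (.assign x (.var l) (.const 0) (.var (l + 1)))

/-- A later hit overwrites an earlier one, and both satisfy `φ` in the initial memory, so it
suffices to track that the entry is some hit once a hit has been seen. -/
theorem den_choose {l x : ℕ} {φ : Form} (hx : x ≠ 1) (hφ : φ.avoids x) (e : ℕ → ℕ) (σ : Store) :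
    (∀ y, y ≠ x → (choose l x φ).den e σ y = σ y) ∧
    ∀ a < σ 1 0 0,
      (∃ c < σ 1 0 0, φ.Holds (Function.update (Function.update e l a) (l + 1) c) σ) →
      ∃ c < σ 1 0 0, φ.Holds (Function.update (Function.update e l a) (l + 1) c) σ ∧
        (choose l x φ).den e σ x a 0 = c := by
  have := den_forForCond_induction (l := l) (φ := φ) (e := e) (σ := σ)
    (s := .assign x (.var l) (.const 0) (.var (l + 1)))
    (fun a b τ => (∀ y, y ≠ x → τ y = σ y) ∧ ∀ a' < σ 1 0 0,
      (∃ c < σ 1 0 0, (a' < a ∨ (a' = a ∧ c < b)) ∧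
        φ.Holds (Function.update (Function.update e l a') (l + 1) c) σ) →
      ∃ c < σ 1 0 0, φ.Holds (Function.update (Function.update e l a') (l + 1) c) σ ∧
        τ x a' 0 = c)
    (fun a b τ h => by rw [h.1 1 hx.symm])
    ⟨fun _ _ => rfl, by
      rintro a' - ⟨c, -, h, -⟩
      omega⟩
    (by
      rintro a τ ⟨h1, h2⟩
      refine ⟨h1, ?_⟩
      rintro a' ha' ⟨c, hc, h, h'⟩
      exact h2 a' ha' ⟨c, hc, by omega, h'⟩)
    (by
      rintro a ha b hb τ ⟨h1, h2⟩ h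
      rw [Form.holds_congr h1 φ hφ] at h
      have h3 : Function.update (Function.update e l a) (l + 1) b l = a := by
        rw [Function.update_of_ne (by omega), Function.update_self]
      simp only [den, Tm.eval, h3, Function.update_self]
      refine ⟨fun y hy => by rw [Store.write_of_ne hy, h1 y hy], ?_⟩
      rintro a' ha' ⟨c, hc, hlt, h'⟩
      by_cases haa : a' = a
      · subst haa
        exact ⟨b, hb, h, Store.write_self⟩
      · obtain ⟨d, hd, hd', hv⟩ := h2 a' ha' ⟨c, hc, by omega, h'⟩
        exact ⟨d, hd, hd', by simp [Store.write, haa, hv]⟩)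
    (by
      rintro a ha b hb τ ⟨h1, h2⟩ h
      rw [Form.holds_congr h1 φ hφ] at h
      refine ⟨h1, ?_⟩
      rintro a' ha' ⟨c, hc, hlt, h'⟩
      by_cases hac : a' = a ∧ c = b
      · obtain ⟨rfl, rfl⟩ := hac
        exact absurd h' h
      · exact h2 a' ha' ⟨c, hc, by omega, h'⟩)
  refine ⟨this.1, fun a ha h => this.2 a ha ?_⟩
  obtain ⟨c, hc, h⟩ := h
  exact ⟨c, hc, Or.inl ha, h⟩

end Stmt

end RAM

/-! ## Maximum matchings by auctions

Every right vertex has a price and possibly an owner. An unmatched left vertex `a` bids on a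
cheapest neighbour `c`, provided that its price is less than `m`: then `a` replaces the owner of
`c`, and the price of `c` increases by one. When no bid is possible, the matching is maximum. -/

section Auction

/-- The invariants of the auction. The owner `a` of a right vertex is encoded as `a + 1`, and `0`
stands for no owner. -/
structure IsAuction {m : ℕ} (R : Fin m → Fin m → Prop) (own price : Fin m → ℕ) : Prop where
  range : ∀ c, own c = 0 ∨ ∃ a : Fin m, own c = a + 1
  edge : ∀ (a c : Fin m), own c = a + 1 → R a c
  inj : ∀ c c', own c = own c' → own c ≠ 0 → c = c'
  free : ∀ c, own c = 0 → price c = 0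
  bound : ∀ c, price c ≤ m
  slack : ∀ (a c c' : Fin m), own c = a + 1 → R a c' → price c ≤ price c' + 1

/-- The left vertex `a` can bid on `c`. -/
def CanBid {m : ℕ} (R : Fin m → Fin m → Prop) (own price : Fin m → ℕ) (a c : Fin m) : Prop :=
  R a c ∧ (∀ c', own c' ≠ a + 1) ∧ price c < m ∧ ∀ c', R a c' → price c ≤ price c'

variable {m : ℕ} {R : Fin m → Fin m → Prop} {own price own' price' : Fin m → ℕ}

/-- The bidder owned nothing, so owners remain distinct. It picks a cheapest neighbour, so after the
increment the price is at most one above that of any neighbour. For the other owners the slack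
survives because prices never decrease. -/
theorem IsAuction.bid (h : IsAuction R own price) {a c : Fin m} (hb : CanBid R own price a c)
    (ho : own' c = a + 1) (ho' : ∀ d, d ≠ c → own' d = own d) (hp : price' c = price c + 1)
    (hp' : ∀ d, d ≠ c → price' d = price d) : IsAuction R own' price' := by
  obtain ⟨hR, hfree, hlt, hmin⟩ := hb
  have hle : ∀ d, price d ≤ price' d := fun d => by
    by_cases hd : d = c
    · subst hd
      omega
    · rw [hp' d hd]
  refine ⟨fun d => ?_, fun b d hd => ?_, fun d d' hd hd0 => ?_, fun d hd => ?_, fun d => ?_,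
    fun b d d' hd hd' => ?_⟩ <;> by_cases hdc : d = c
  · exact Or.inr ⟨a, hdc ▸ ho⟩
  · rw [ho' d hdc]
    exact h.range d
  · subst hdc
    have : a = b := Fin.ext (by omega)
    exact this ▸ hR
  · exact h.edge b d (ho' d hdc ▸ hd)
  · by_contra hne
    subst hdc
    rw [ho' d' (Ne.symm hne), ho] at hd
    exact hfree d' hd.symm
  · by_cases hdc' : d' = c
    · subst hdc'
      rw [ho' d hdc, ho] at hd
      exact absurd hd (hfree d)
    · rw [ho' d hdc, ho' d' hdc'] at hd
      exact h.inj d d' hd (ho' d hdc ▸ hd0)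
  · subst hdc
    omega
  · rw [hp' d hdc]
    exact h.free d (ho' d hdc ▸ hd)
  · subst hdc
    omega
  · rw [hp' d hdc]
    exact h.bound d
  · subst hdc
    obtain rfl : a = b := Fin.ext (by omega)
    have := hmin d' hd'
    have := hle d'
    omega
  · rw [hp' d hdc]
    have := h.slack b d d' (ho' d hdc ▸ hd) hd'
    have := hle d'
    omega

/-- When no bid is possible, all neighbours of an unmatched left vertex have price `m`. -/
theorem IsAuction.le_price (hstuck : ∀ a c, ¬ CanBid R own price a c) {a c : Fin m} (hR : R a c)
    (hfree : ∀ c', own c' ≠ a + 1) : m ≤ price c := by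
  obtain ⟨d, hd, hmin⟩ := Set.exists_min_image {d | R a d} price (Set.toFinite _) ⟨c, hR⟩
  by_contra hlt
  exact hstuck a d ⟨hd, hfree, by have := hmin c hR; omega, hmin⟩

/-- If some vertex is not a left vertex, then some price does not occur. -/
theorem IsAuction.exists_gap (h : IsAuction R own price) {s : Fin m} (hs : ∀ c, ¬ R s c) :
    ∃ k, 1 ≤ k ∧ k ≤ m ∧ ∀ c, price c ≠ k := by
  by_contra! hgap
  -- If all prices `1, …, m` occurred, right vertices with these prices would be owned, since a free
  -- one costs `0`. Their `m` distinct owners would include `s`, which has no edges.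
  have key : ∀ k : Fin m, ∃ (c a : Fin m), price c = k + 1 ∧ own c = a + 1 := fun k => by
    obtain ⟨c, hc⟩ := hgap (k + 1) (by omega) (by omega)
    rcases h.range c with h0 | ⟨a, ha⟩
    · have := h.free c h0
      omega
    · exact ⟨c, a, hc, ha⟩
  choose c a hc ha using key
  have hinj : Function.Injective a := fun k k' hk => by
    have := h.inj (c k) (c k') (by rw [ha, ha, hk]) (by rw [ha]; omega)
    have h1 := hc k
    have h2 := hc k'
    rw [this] at h1
    exact Fin.ext (by omega)
  obtain ⟨k, hk⟩ := Finite.surjective_of_injective hinj s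
  exact hs (c k) (hk ▸ h.edge _ _ (ha k))

/-- When no bid is possible, the owners form a maximum matching. -/
theorem IsAuction.isMaximumMatching {D : Digraph (Fin m)} {s t : Fin m}
    (h : IsAuction (fun a c => D.Adj a c ∧ a ≠ s ∧ a ≠ t) own price)
    (hstuck : ∀ a c, ¬ CanBid (fun a c => D.Adj a c ∧ a ≠ s ∧ a ≠ t) own price a c) :
    IsMaximumMatching (matchingOf (D := D) (s := s) (t := t)
      (R := fun a c => own c = a.1 + 1) fun a c hac => (h.edge a.1 c hac).1) := by
  have hM : (matchingOf (D := D) (s := s) (t := t) (R := fun a c => own c = a.1 + 1)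
      fun a c hac => (h.edge a.1 c hac).1).IsMatching := by
    refine matchingOf_isMatching _ (fun a c c' hc hc' => h.inj c c' (hc.trans hc'.symm) (by omega))
      fun a a' c hc hc' => Subtype.ext (Fin.ext (by omega))
  refine ⟨hM, fun M' hM' => ?_⟩
  rw [ncard_edgeSet_eq hM, ncard_edgeSet_eq hM', matchedRight_matchingOf]
  obtain ⟨k, hk1, hkm, hk⟩ := h.exists_gap (s := s) (fun c hc => hc.2.1 rfl)
  -- The vertices matched by `M'` are mapped injectively to owned vertices. If `c` costs more than
  -- the gap `k`, it is owned and is mapped to itself. Otherwise it costs less than `k`, so its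
  -- `M'`-partner `a` owns some `d`: if `a` owned nothing, `c` would cost at least `m`. By slack `d`
  -- costs at most `k`, hence less than `k`.
  have key : ∀ c : Fin m, ∃ d : Fin m, c ∈ matchedRight M' →
      ∃ a, M'.Adj (Sum.inl a) (Sum.inr c) ∧ (∃ b : {a : Fin m // a ≠ s ∧ a ≠ t},
        own d = b.1 + 1) ∧ ((k < price c ∧ d = c) ∨ (price d < k ∧ own d = a.1 + 1)) := by
    intro c
    by_cases hc : c ∈ matchedRight M'
    · obtain ⟨a, ha⟩ := hc
      have hR := matchingGraph_adj.1 ha.adj_sub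
      by_cases hkc : k < price c
      · refine ⟨c, fun _ => ⟨a, ha, ?_, Or.inl ⟨hkc, rfl⟩⟩⟩
        rcases h.range c with h0 | ⟨b, hb⟩
        · have := h.free c h0
          omega
        · exact ⟨⟨b, (h.edge b c hb).2⟩, hb⟩
      · have hkc' := hk c
        have : ∃ d, own d = a.1 + 1 := by
          by_contra! hfree
          have := IsAuction.le_price hstuck ⟨hR, a.2⟩ hfree
          omega
        obtain ⟨d, hd⟩ := this
        have := h.slack a.1 d c hd ⟨hR, a.2⟩
        have := hk d
        exact ⟨d, fun _ => ⟨a, ha, ⟨a, hd⟩, Or.inr ⟨by omega, hd⟩⟩⟩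
    · exact ⟨c, fun h => absurd h hc⟩
  choose g hg using key
  refine Set.ncard_le_ncard_of_injOn g (fun c hc => ?_) fun c hc c' hc' hcc => ?_
  · obtain ⟨a, -, ⟨b, hb⟩, -⟩ := hg c hc
    exact ⟨b, hb⟩
  -- Images of the two kinds lie on different sides of `k`. Within the second kind the owner of the
  -- image is the `M'`-partner, which determines `c`.
  · obtain ⟨a, ha, -, ⟨h1, h2⟩ | ⟨h1, h2⟩⟩ := hg c hc <;>
      obtain ⟨a', ha', -, ⟨h1', h2'⟩ | ⟨h1', h2'⟩⟩ := hg c' hc'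
    · rw [← h2, ← h2', hcc]
    · rw [← hcc, h2] at h1'
      omega
    · rw [hcc, h2'] at h1
      omega
    · rw [hcc, h2'] at h2
      obtain rfl : a' = a := Subtype.ext (Fin.ext (by omega))
      exact Sum.inr_injective (hM'.eq_of_adj_left ha ha')

end Auction

/-! ### The order notions in terms of positions and quantifiers over candidates -/

namespace Profile

variable {C : Type u} {N : Type v} (P : Profile C N)

theorem pos_lt_pos_iff [Finite C] {i : N} {a b : C} :
    P.pos i a < P.pos i b ↔ P.prefers i a b := by
  have key : ∀ {a b}, P.prefers i a b → P.pos i a < P.pos i b := fun {a b} h =>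
    Nat.add_lt_add_right (Set.ncard_lt_ncard (s := {c | P.prefers i c a})
      (t := {c | P.prefers i c b}) ⟨fun c hc => prefers_trans hc h,
        fun hsub => P.prefers_irrefl i a (hsub h)⟩ (Set.toFinite _)) 1
  refine ⟨fun h => ?_, key⟩
  by_cases hab : a = b
  · exact absurd h (by simp [hab])
  · exact (P.prefers_or i hab).resolve_right fun h' => (key h').not_gt h

theorem isBottom_iff {i : N} {S : Set C} {a : C} :
    P.IsBottom i S a ↔ a ∈ S ∧ ∀ b ∈ S, ¬ P.prefers i a b := by
  refine and_congr_right fun _ => ⟨fun h b hb hab => ?_, fun h b hb hba => ?_⟩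
  · exact prefers_asymm hab (h b hb (prefers_ne hab).symm)
  · exact (P.prefers_or i hba).resolve_right (h b hb)

theorem isTop_iff {i : N} {S : Set C} {a : C} :
    P.IsTop i S a ↔ a ∈ S ∧ ∀ b ∈ S, ¬ P.prefers i b a := by
  refine and_congr_right fun _ => ⟨fun h b hb hab => ?_, fun h b hb hba => ?_⟩
  · exact prefers_asymm hab (h b hb (prefers_ne hab))
  · exact (P.prefers_or i hba).resolve_left (h b hb)

/-- This form uses only comparisons by one voter and quantifiers over `S`, so it can be transcribed
into a formula of the language. -/
theorem mem_attachableFor_iff {i : N} {S : Set C} {a c : C} (ha : a ∈ S) :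
    c ∈ P.attachableFor i S a ↔ c ∈ S ∧
      (((∃ b ∈ S, P.prefers i b a) ∧ P.prefers i c a) ∨
        ((¬ ∃ b ∈ S, P.prefers i b a) ∧ c ≠ a ∧ ∀ b ∈ S, b ≠ a → ¬ P.prefers i b c)) := by
  change (¬ P.IsTop i S a ∧ c ∈ S ∧ P.prefers i c a) ∨ (P.IsTop i S a ∧ P.IsSecond i S c) ↔ _
  by_cases h : P.IsTop i S a
  · have h' : ¬ ∃ b ∈ S, P.prefers i b a := by rwa [← P.not_isTop_iff ha, not_not]
    simp only [h, h', not_true_eq_false, not_false_eq_true, false_and, true_and, false_or]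
    constructor
    · rintro ⟨t, ht, hc⟩
      obtain rfl := ht.unique h
      have := P.isTop_iff.1 hc
      exact ⟨this.1.1, this.1.2, fun b hb hbt => this.2 b ⟨hb, hbt⟩⟩
    · rintro ⟨hc, hca, hmin⟩
      exact ⟨a, h, P.isTop_iff.2 ⟨⟨hc, hca⟩, fun b hb => hmin b hb.1 hb.2⟩⟩
  · have h' := (P.not_isTop_iff ha).1 h
    simp only [h, h', not_true_eq_false, not_false_eq_true, false_and, true_and, or_false]

end Profile

namespace RAM

theorem forall_lt_iff_fin {m : ℕ} {p : ℕ → Prop} : (∀ v < m, p v) ↔ ∀ v : Fin m, p v :=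
  ⟨fun h v => h v v.2, fun h v hv => h ⟨v, hv⟩⟩

theorem exists_lt_iff_fin {m : ℕ} {p : ℕ → Prop} : (∃ v < m, p v) ↔ ∃ v : Fin m, p v :=
  ⟨fun ⟨v, hv, h⟩ => ⟨⟨v, hv⟩, h⟩, fun ⟨v, h⟩ => ⟨v, v.2, h⟩⟩

/-! ## The construction of the attachment digraph -/

namespace Form

/-- Implication. -/
def imp (φ ψ : Form) : Form := neg (and φ (neg ψ))

theorem holds_imp {e : ℕ → ℕ} {σ : Store} {φ ψ : Form} :
    (φ.imp ψ).Holds e σ ↔ (φ.Holds e σ → ψ.Holds e σ) := by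
  simp only [imp, Holds]
  tauto

/-- Variable `k` is a remaining candidate. The removed candidates are marked in array `9`. -/
def alive (k : ℕ) : Form := .eq (.entry 9 (.var k) (.const 0)) (.const 0)

/-- Voter `i` prefers `a` to `b`. -/
def pref (i a b : ℕ) : Form := .lt (.entry 0 (.var i) (.var a)) (.entry 0 (.var i) (.var b))

/-- Equality of variables. -/
def same (a b : ℕ) : Form := .eq (.var a) (.var b)

/-- The relation in array `x` holds for two variables. -/
def rel (x a b : ℕ) : Form := .eq (.entry x (.var a) (.var b)) (.const 1)

/-- At least three candidates remain. -/
def three : Form := .ex 1 3 (.ex 1 4 (.ex 1 5 (.and (.and (alive 3) (.and (alive 4) (alive 5)))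
  (.and (.neg (same 3 4)) (.and (.neg (same 3 5)) (.neg (same 4 5)))))))

/-- Variable `1` is ranked last by some voter among at least three remaining candidates. -/
def bottom : Form := .and three (.and (alive 1)
  (.ex 2 3 (.all 1 4 ((alive 4).imp (.neg (pref 3 1 4))))))

/-- Variable `2` can be attached to variable `1`, which is ranked last by some voter. -/
def arc : Form := .and (.and (.eq (.entry 10 (.var 1) (.const 0)) (.const 1)) (alive 1))
  (.all 2 3 (.and (alive 2) (.or
    (.and (.ex 1 4 (.and (alive 4) (pref 3 4 1))) (pref 3 2 1))
    (.and (.neg (.ex 1 4 (.and (alive 4) (pref 3 4 1)))) (.and (.neg (same 2 1))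
      (.all 1 4 ((alive 4).imp ((Form.neg (same 4 1)).imp (.neg (pref 3 4 2))))))))))

end Form

/-- A round of the construction of the attachment digraph. -/
def roundStmt : Stmt :=
  .seq (.addRel 1 10 .bottom) (.seq (.addRel 1 3 .arc)
    (.addRel 1 9 (.eq (.entry 10 (.var 1) (.const 0)) (.const 1))))

/-- The construction of the attachment digraph. -/
def digraphStmt : Stmt :=
  .seq (.loop 0 roundStmt)
    (.addRel 0 3 (.and (Form.alive 0) (.and (Form.alive 1) (.lt (.var 0) (.var 1)))))

/-- The set of remaining candidates. -/
def aliveSet (m : ℕ) (σ : Store) : Set (Fin m) := {a | σ 9 a 0 = 0}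

/-- The memory contains the input. -/
structure HoldsInput {m n : ℕ} (P : Profile (Fin m) (Fin n)) (σ : Store) : Prop where
  pos : ∀ (i : Fin n) (a : Fin m), σ 0 i a = P.pos i a
  card : σ 1 0 0 = m
  voters : σ 2 0 0 = n

/-! ### Correctness of the construction of the attachment digraph -/

section Semantics

variable {m n : ℕ} {P : Profile (Fin m) (Fin n)} {σ : Store} {e : ℕ → ℕ}

theorem holds_three (h1 : σ 1 0 0 = m) :
    Form.three.Holds e σ ↔ 3 ≤ (aliveSet m σ).ncard := by
  rw [Nat.succ_le_iff, Set.two_lt_ncard_iff]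
  simp only [Form.three, Form.holds_ex, Form.Holds, Form.alive, Form.same, Tm.eval, h1,
    exists_lt_iff_fin]
  simp [aliveSet, Function.update, Fin.ext_iff, and_assoc]

theorem holds_bottom (h : HoldsInput P σ) {a : Fin m} (he : e 1 = a) :
    Form.bottom.Holds e σ ↔
      3 ≤ (aliveSet m σ).ncard ∧ a ∈ P.bottoms (aliveSet m σ) := by
  rw [Form.bottom, Form.Holds, holds_three h.card]
  refine and_congr_right fun _ => ?_
  simp only [Form.holds_ex, Form.Holds, Form.holds_imp, Form.alive, Form.pref, Tm.eval, h.card,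
    h.voters, exists_lt_iff_fin, forall_lt_iff_fin]
  simp [Function.update, he, h.pos, P.pos_lt_pos_iff, Profile.bottoms, P.isBottom_iff, aliveSet]

theorem holds_arc (h : HoldsInput P σ) [Nonempty (Fin n)] {a b : Fin m} (h1 : e 1 = a)
    (h2 : e 2 = b) : Form.arc.Holds e σ ↔ (σ 10 a 0 = 1 ∧ a ∈ aliveSet m σ) ∧
      b ∈ P.attachable (aliveSet m σ) a := by
  rw [Form.arc, Form.Holds]
  simp only [Form.holds_ex, Form.holds_or, Form.Holds, Form.holds_imp, Form.alive, Form.pref,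
    Form.same, Tm.eval, h.card, h.voters, exists_lt_iff_fin, forall_lt_iff_fin]
  rw [h1]
  change (σ 10 a 0 = 1 ∧ a ∈ aliveSet m σ) ∧ _ ↔ _
  refine and_congr_right fun ha => ?_
  rw [Profile.attachable, Set.mem_iInter]
  refine forall_congr' fun i => ?_
  rw [P.mem_attachableFor_iff ha.2]
  simp [Function.update, h1, h2, h.pos, P.pos_lt_pos_iff, aliveSet, Fin.ext_iff]

/-- The memory after a round. -/
theorem den_roundStmt (h : HoldsInput P σ) [Nonempty (Fin n)] (e : ℕ → ℕ) {τ : Store}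
    (hτ : τ = roundStmt.den e σ) (hmark : ∀ a : Fin m, σ 10 a 0 = 1 ↔ a ∉ aliveSet m σ) :
    (∀ y, y ≠ 3 → y ≠ 9 → y ≠ 10 → τ y = σ y) ∧
    (∀ a : Fin m, a ∈ aliveSet m τ ↔ a ∈ aliveSet m σ ∧
      ¬ (3 ≤ (aliveSet m σ).ncard ∧ a ∈ P.bottoms (aliveSet m σ))) ∧
    (∀ a : Fin m, τ 10 a 0 = 1 ↔ a ∉ aliveSet m τ) ∧
    ∀ a b : Fin m, (τ 3 a b = 1 ↔ ((3 ≤ (aliveSet m σ).ncard ∧ a ∈ P.bottoms (aliveSet m σ)) ∧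
      b ∈ P.attachable (aliveSet m σ) a) ∨ σ 3 a b = 1) ∧
      (τ 3 a b = 0 ↔ ¬ ((3 ≤ (aliveSet m σ).ncard ∧ a ∈ P.bottoms (aliveSet m σ)) ∧
        b ∈ P.attachable (aliveSet m σ) a) ∧ σ 3 a b = 0) := by
  set S := aliveSet m σ with hS
  -- The candidates to be removed are first marked in array `10`. Array `9` keeps the old set `S`
  -- until the arcs of the round have been computed, and only then receives the marks.
  set σ₁ := (Stmt.addRel 1 10 .bottom).den e σ with hσ₁
  set σ₂ := (Stmt.addRel 1 3 .arc).den e σ₁ with hσ₂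
  have hτ' : τ = (Stmt.addRel 1 9 (.eq (.entry 10 (.var 1) (.const 0)) (.const 1))).den e σ₂ := hτ
  have f₁ : ∀ y, y ≠ 10 → σ₁ y = σ y := fun y hy =>
    Stmt.den_addRel_of_ne (by omega) (by rfl) e σ hy
  have f₂ : ∀ y, y ≠ 3 → σ₂ y = σ₁ y := fun y hy =>
    Stmt.den_addRel_of_ne (by omega) (by rfl) e σ₁ hy
  have f₃ : ∀ y, y ≠ 9 → τ y = σ₂ y := fun y hy => by
    rw [hτ', Stmt.den_addRel_of_ne (by omega) (by rfl) e σ₂ hy]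
  have hinp : HoldsInput P σ₁ := by
    refine ⟨?_, ?_, ?_⟩ <;> simp only [f₁ _ (show 0 ≠ 10 by omega), f₁ _ (show 1 ≠ 10 by omega),
      f₁ _ (show 2 ≠ 10 by omega)]
    exacts [h.pos, h.card, h.voters]
  have hc : σ₂ 1 0 0 = m := by rw [f₂ 1 (by omega), hinp.card]
  have hS₁ : aliveSet m σ₁ = S := by
    simp only [hS, aliveSet, f₁ 9 (by omega)]
  have h10 : ∀ a : Fin m, σ₁ 10 a 0 = 1 ↔ (3 ≤ S.ncard ∧ a ∈ P.bottoms S) ∨ a ∉ S := by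
    intro a
    have hm : 0 < m := by have := a.2; omega
    rw [Stmt.den_addRel_eq_one_iff (by omega) (by rfl) e σ (h.card ▸ a.2) (h.card ▸ hm),
      holds_bottom h (a := a) (by simp [Function.update]), hmark]
  -- Marks of earlier rounds are never erased, so the candidates of this round are those that are
  -- marked and still remain.
  have h10' : ∀ a : Fin m, (σ₁ 10 a 0 = 1 ∧ a ∈ S) ↔ (3 ≤ S.ncard ∧ a ∈ P.bottoms S) := by
    intro a
    rw [h10]
    have := fun h => P.bottoms_subset S (a := a) h
    tauto
  have h9 : ∀ a : Fin m, a ∈ aliveSet m τ ↔ a ∈ S ∧ ¬ σ₁ 10 a 0 = 1 := by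
    intro a
    have hm : 0 < m := by have := a.2; omega
    change τ 9 a 0 = 0 ↔ σ 9 a 0 = 0 ∧ _
    rw [hτ', Stmt.den_addRel_eq_zero_iff (by omega) (by rfl) e σ₂ (hc ▸ a.2) (hc ▸ hm),
      f₂ 9 (by omega), f₁ 9 (by omega), and_comm]
    simp [Form.Holds, Tm.eval, Function.update, f₂ 10 (by omega)]
  refine ⟨fun y hy hy' hy'' => ?_, fun a => ?_, fun a => ?_, fun a b => ?_⟩
  · rw [f₃ y hy', f₂ y hy, f₁ y hy'']
  · rw [h9, h10]
    tauto
  · rw [h9, f₃ 10 (by omega), f₂ 10 (by omega), h10]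
    tauto
  · have ha : (a : ℕ) < σ₁ 1 0 0 := hinp.card ▸ a.2
    have hb : (b : ℕ) < σ₁ 1 0 0 := hinp.card ▸ b.2
    rw [f₃ 3 (by omega), Stmt.den_addRel_eq_one_iff (by omega) (by rfl) e σ₁ ha hb,
      Stmt.den_addRel_eq_zero_iff (by omega) (by rfl) e σ₁ ha hb,
      holds_arc hinp (a := a) (b := b) (by simp [Function.update]) (by simp [Function.update]),
      hS₁, h10', f₁ 3 (by omega)]
    exact ⟨Iff.rfl, Iff.rfl⟩

/-- The invariants of the construction of the attachment digraph after `k` rounds. -/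
structure DigraphInvariant (P : Profile (Fin m) (Fin n)) (T : SimpleGraph (Fin m)) (σ₀ : Store)
    (k : ℕ) (σ : Store) : Prop where
  frame : ∀ y, y ≠ 3 → y ≠ 9 → y ≠ 10 → σ y = σ₀ y
  zero_one : ∀ a b : Fin m, σ 3 a b = 0 ∨ σ 3 a b = 1
  mark : ∀ a : Fin m, σ 10 a 0 = 1 ↔ a ∉ aliveSet m σ
  loc : P.LocallySinglePeaked T (aliveSet m σ)
  nonempty : (aliveSet m σ).Nonempty
  small : (aliveSet m σ).ncard < 3 ∨ (aliveSet m σ).ncard + k ≤ m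
  builds : ∀ D, P.Builds (aliveSet m σ) D →
    P.IsAttachmentDigraph { Adj := fun x y => σ 3 x y = 1 ∨ D.Adj x y }

/-- With at least three candidates left, the round matches the constructor `Builds.round`: the tree
guarantees that it does not fail and that candidates remain. With fewer, the guard `three` makes the
round idle. -/
theorem DigraphInvariant.step [Nonempty (Fin n)] {T : SimpleGraph (Fin m)} (hT : T.IsAcyclic)
    {σ₀ : Store} (h₀ : HoldsInput P σ₀) {k : ℕ} (h : DigraphInvariant P T σ₀ k σ) (e : ℕ → ℕ) :
    DigraphInvariant P T σ₀ (k + 1) (roundStmt.den e σ) := by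
  have hinp : HoldsInput P σ := by
    refine ⟨?_, ?_, ?_⟩ <;> rw [h.frame _ (by omega) (by omega) (by omega)]
    exacts [h₀.pos, h₀.card, h₀.voters]
  obtain ⟨hf, ha, hm, h01⟩ := den_roundStmt hinp e rfl h.mark
  set τ := roundStmt.den e σ
  have h01' : ∀ a b : Fin m, τ 3 a b = 0 ∨ τ 3 a b = 1 := fun a b => by
    have h1 := h01 a b
    have h2 := h.zero_one a b
    tauto
  have hf' : ∀ y, y ≠ 3 → y ≠ 9 → y ≠ 10 → τ y = σ₀ y := fun y hy hy' hy'' =>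
    (hf y hy hy' hy'').trans (h.frame y hy hy' hy'')
  by_cases h3 : 3 ≤ (aliveSet m σ).ncard
  · have hS : aliveSet m τ = aliveSet m σ \ P.bottoms (aliveSet m σ) := by
      ext a
      rw [ha]
      simp [h3]
    refine ⟨hf', h01', hm, ?_, ?_, ?_, fun D hD => ?_⟩
    · rw [hS]
      exact h.loc.sdiff_bottoms hT h3
    · rw [hS]
      exact h.loc.sdiff_bottoms_nonempty hT h3
    · have := P.ncard_sdiff_bottoms_lt h.nonempty
      have := h.small
      rw [hS]
      omega
    · rw [hS] at hD
      convert h.builds _ (.round _ D h3 (fun a ha => h.loc.attachable_nonempty hT h3 ha) hD)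
        using 4 with x y
      rw [(h01 x y).1]
      tauto
  · have hS : aliveSet m τ = aliveSet m σ := by
      ext a
      rw [ha]
      simp [h3]
    have h3' : ∀ a b : Fin m, τ 3 a b = 1 ↔ σ 3 a b = 1 := fun a b => by
      rw [(h01 a b).1]
      tauto
    refine ⟨hf', h01', hm, hS ▸ h.loc, hS ▸ h.nonempty, Or.inl (by rw [hS]; omega), fun D hD => ?_⟩
    rw [hS] at hD
    simp only [h3']
    exact h.builds D hD

/-- Correctness of the construction of the attachment digraph. -/
theorem den_digraphStmt [Nonempty (Fin n)] [Nonempty (Fin m)] {T : SimpleGraph (Fin m)}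
    (hT : T.IsAcyclic) (hloc : P.LocallySinglePeaked T Set.univ) (h₀ : HoldsInput P σ)
    (hz : ∀ x i j, 3 ≤ x → σ x i j = 0) (e : ℕ → ℕ) :
    ∃ D, P.IsAttachmentDigraph D ∧ HoldsRelation (digraphStmt.den e σ) 3 D.Adj ∧
      ∀ y, y ≠ 3 → y ≠ 9 → y ≠ 10 → digraphStmt.den e σ y = σ y := by
  have hSu : aliveSet m σ = Set.univ := by
    ext a
    simp [aliveSet, hz]
  have hinv : DigraphInvariant P T σ m ((Stmt.loop 0 roundStmt).den e σ) := by
    have := Stmt.den_loop_induction (k := 0) (s := roundStmt) (e := e) (σ := σ)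
      (fun k τ => DigraphInvariant P T σ k τ) ?_ (fun k _ τ h => h.step hT h₀ _)
    · rwa [h₀.card] at this
    · refine ⟨fun _ _ _ _ => rfl, fun a b => Or.inl (hz _ _ _ le_rfl), fun a => ?_, hSu ▸ hloc,
        hSu ▸ Set.univ_nonempty, Or.inr ?_, fun D hD => ?_⟩
      · simp [hSu, hz]
      · simp [hSu, Set.ncard_univ]
      · rw [hSu] at hD
        simp only [hz, zero_ne_one, le_refl, false_or]
        exact hD
  set τ := (Stmt.loop 0 roundStmt).den e σ
  have hden : digraphStmt.den e σ = (Stmt.addRel 0 3 (.and (Form.alive 0)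
    (.and (Form.alive 1) (.lt (.var 0) (.var 1))))).den e τ := rfl
  have hc : τ 1 0 0 = m := by rw [hinv.frame 1 (by omega) (by omega) (by omega), h₀.card]
  have hv : ∀ a b : Fin m, (Form.and (Form.alive 0) (.and (Form.alive 1)
      (.lt (.var 0) (.var 1)))).Holds (Function.update (Function.update e 0 a) (0 + 1) b) τ ↔
      a ∈ aliveSet m τ ∧ b ∈ aliveSet m τ ∧ a < b := by
    intro a b
    simp only [Form.Holds, Form.alive, Tm.eval]
    simp [Function.update, aliveSet]
  -- Each effective round removes a candidate, so if all `m` rounds had been effective, nothing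
  -- would remain.
  have hcard : (aliveSet m τ).ncard < 3 := by
    have h1 := hinv.small
    have h2 := (Set.ncard_pos (Set.toFinite _)).2 hinv.nonempty
    omega
  -- The last arc is directed from the smaller to the larger number. If a single candidate is left,
  -- the same formula adds no arc.
  obtain ⟨D, hD, hD'⟩ : ∃ D, P.Builds (aliveSet m τ) D ∧
      ∀ a b, D.Adj a b ↔ a ∈ aliveSet m τ ∧ b ∈ aliveSet m τ ∧ a < b := by
    by_cases h2 : (aliveSet m τ).ncard = 2
    · obtain ⟨a, b, hab, hS⟩ := Set.ncard_eq_two.1 h2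
      have key : ∀ a b : Fin m, a < b → aliveSet m τ = {a, b} → ∃ D,
          P.Builds (aliveSet m τ) D ∧
            ∀ a b, D.Adj a b ↔ a ∈ aliveSet m τ ∧ b ∈ aliveSet m τ ∧ a < b := by
        intro a b hab hS
        rw [hS]
        refine ⟨_, .pair a b hab.ne, fun x y => ?_⟩
        simp only [ Set.mem_insert_iff, Set.mem_singleton_iff]
        grind
      rcases lt_or_gt_of_ne hab with h | h
      · exact key a b h hS
      · exact key b a h (hS.trans (Set.pair_comm a b))
    · have hsub := Set.ncard_le_one_iff_subsingleton.1
        (show (aliveSet m τ).ncard ≤ 1 by omega)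
      refine ⟨_, .small _ hsub, fun a b => ⟨False.elim, fun h => ?_⟩⟩
      exact absurd (hsub h.1 h.2.1) h.2.2.ne
  refine ⟨_, hinv.builds D hD, fun a b => ?_, fun y hy hy' hy'' => ?_⟩
  · have ha : (a : ℕ) < τ 1 0 0 := hc ▸ a.2
    have hb : (b : ℕ) < τ 1 0 0 := hc ▸ b.2
    have h1 := hinv.zero_one a b
    rw [hden, Stmt.den_addRel_eq_one_iff (by omega) (by rfl) e τ ha hb,
      Stmt.den_addRel_eq_zero_iff (by omega) (by rfl) e τ ha hb, hv, ← hD']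
    dsimp only
    have h2 : τ 3 a b = 0 → ¬ τ 3 a b = 1 := by omega
    tauto
  · rw [← hinv.frame y hy hy' hy'', hden, Stmt.den_addRel_of_ne (by omega) (by rfl) e τ hy]

end Semantics

end RAM

/-! ### The auction and the whole algorithm as statements -/

namespace RAM

namespace Form

/-- Variable `k` is the vertex `s`. -/
def isSource (k : ℕ) : Form := .eq (.var k) (.entry 4 (.const 0) (.const 0))

/-- Variable `k` is the vertex `t`. -/
def isSink (k : ℕ) : Form := .eq (.var k) (.entry 5 (.const 0) (.const 0))

/-- Variable `1` has no outgoing arcs. -/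
def sink : Form := .all 1 2 (.neg (rel 3 1 2))

/-- Variable `1` has a unique outgoing arc, to the sink. -/
def source : Form :=
  .all 1 2 (.and ((rel 3 1 2).imp (isSink 2)) ((isSink 2).imp (rel 3 1 2)))

/-- Variable `a` owns variable `c` in the auction. -/
def owns (a c : ℕ) : Form := .eq (.entry 14 (.var c) (.const 0)) (.add (.var a) (.const 1))

/-- Variable `2` can bid on variable `3`. -/
def bid : Form :=
  .and (.and (rel 3 2 3) (.and (.neg (isSource 2)) (.neg (isSink 2))))
    (.and (.all 1 4 (.neg (owns 2 4)))
      (.and (.lt (.entry 13 (.var 3) (.const 0)) (.entry 1 (.const 0) (.const 0)))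
        (.all 1 4 ((Form.and (rel 3 2 4) (.and (.neg (isSource 2)) (.neg (isSink 2)))).imp
          (.neg (.lt (.entry 13 (.var 4) (.const 0)) (.entry 13 (.var 3) (.const 0))))))))

/-- Variable `1` is a possible value of the attachment function at variable `0`. -/
def value : Form :=
  .and (.neg (isSink 0)) (.and (rel 3 0 1) (.or (rel 6 0 1) (.all 1 2 (.neg (rel 6 0 2)))))

/-- The variables `0` and `1` are adjacent in the tree of the attachment function. -/
def treeAdj : Form :=
  .and (.neg (same 0 1)) (.or (.and (.neg (isSink 0)) (.eq (.entry 7 (.var 0) (.const 0)) (.var 1)))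
    (.and (.neg (isSink 1)) (.eq (.entry 7 (.var 1) (.const 0)) (.var 0))))

end Form

/-- A bid of variable `2` on variable `3`. -/
def bidStmt : Stmt :=
  .seq (.assign 14 (.var 3) (.const 0) (.add (.var 2) (.const 1)))
    (.assign 13 (.var 3) (.const 0) (.add (.entry 13 (.var 3) (.const 0)) (.const 1)))

/-- The auction. -/
def auctionStmt : Stmt := .loop 0 (.loop 1 (.forForCond 2 .bid bidStmt))

/-- The whole algorithm. -/
def minLeavesStmt : Stmt :=
  .seq digraphStmt (.seq (.choose 0 5 .sink) (.seq (.choose 0 4 .source) (.seq auctionStmt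
    (.seq (.addRel 0 6 (.owns 0 1)) (.seq (.choose 0 7 .value) (.addRel 0 8 .treeAdj))))))

/-! ### Correctness of the auction and of the whole algorithm -/

section Semantics

variable {m : ℕ} {D : Digraph (Fin m)} {s t : Fin m} {σ : Store} {e : ℕ → ℕ}

theorem HoldsRelation.eq_one_iff {x : ℕ} {R : Fin m → Fin m → Prop} (h : HoldsRelation σ x R)
    (a b : Fin m) : σ x a b = 1 ↔ R a b := by
  refine ⟨fun h1 => ?_, (h a b).1⟩
  by_contra hR
  have := (h a b).2 hR
  omega

/-- The relation that is added to an empty array. -/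
theorem holdsRelation_addRel {x : ℕ} {φ : Form} {R : Fin m → Fin m → Prop} (hx : x ≠ 1)
    (hφ : φ.avoids x) (hm : σ 1 0 0 = m) (hz : ∀ i j, σ x i j = 0)
    (hR : ∀ a b : Fin m, φ.Holds (Function.update (Function.update e 0 a) (0 + 1) b) σ ↔ R a b) :
    HoldsRelation ((Stmt.addRel 0 x φ).den e σ) x R := by
  intro a b
  rw [Stmt.den_addRel_eq_one_iff hx hφ e σ (hm ▸ a.2) (hm ▸ b.2),
    Stmt.den_addRel_eq_zero_iff hx hφ e σ (hm ▸ a.2) (hm ▸ b.2), hR, hz]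
  tauto

/-- The memory contains the digraph `D` and the vertices `s` and `t`. -/
structure HoldsDigraph (D : Digraph (Fin m)) (s t : Fin m) (σ : Store) : Prop where
  card : σ 1 0 0 = m
  digraph : HoldsRelation σ 3 D.Adj
  source : σ 4 0 0 = s
  sink : σ 5 0 0 = t

theorem HoldsDigraph.congr {τ : Store} (h : HoldsDigraph D s t σ) (h1 : τ 1 = σ 1)
    (h3 : τ 3 = σ 3) (h4 : τ 4 = σ 4) (h5 : τ 5 = σ 5) : HoldsDigraph D s t τ := by
  refine ⟨h1 ▸ h.card, ?_, h4 ▸ h.source, h5 ▸ h.sink⟩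
  intro a b
  rw [h3]
  exact h.digraph a b

/-- The owners that are stored in the memory. -/
def owner (m : ℕ) (σ : Store) (c : Fin m) : ℕ := σ 14 c 0

/-- The prices that are stored in the memory. -/
def price (m : ℕ) (σ : Store) (c : Fin m) : ℕ := σ 13 c 0

/-- The edges of the bipartite graph. -/
def bidders (D : Digraph (Fin m)) (s t : Fin m) (a c : Fin m) : Prop :=
  D.Adj a c ∧ a ≠ s ∧ a ≠ t

theorem holds_bid (h : HoldsDigraph D s t σ) {a c : Fin m} (h2 : e 2 = a) (h3 : e 3 = c) :
    Form.bid.Holds e σ ↔ CanBid (bidders D s t) (owner m σ) (price m σ) a c := by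
  simp only [Form.bid, Form.Holds, Form.holds_imp, Form.rel, Form.isSource, Form.isSink,
    Form.owns, Tm.eval, h.card, h.source, h.sink, forall_lt_iff_fin]
  simp [Function.update, h2, h3, h.digraph.eq_one_iff, CanBid, bidders, owner, price, Fin.ext_iff]

/-- The invariants of the auction after `k` sweeps. -/
structure AuctionInvariant (D : Digraph (Fin m)) (s t : Fin m) (σ₀ : Store) (k : ℕ) (σ : Store) :
    Prop where
  frame : ∀ y, y ≠ 13 → y ≠ 14 → σ y = σ₀ y
  auction : IsAuction (bidders D s t) (owner m σ) (price m σ)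
  progress : k ≤ ∑ c, price m σ c ∨
    ∀ a c, ¬ CanBid (bidders D s t) (owner m σ) (price m σ) a c

/-- A sweep tests all pairs. A bid raises the sum of the prices by one. If none is made, the memory
does not change, so every test still applies at the end and no bid is possible. -/
theorem AuctionInvariant.step {σ₀ : Store} (h₀ : HoldsDigraph D s t σ₀) {k : ℕ}
    (h : AuctionInvariant D s t σ₀ k σ) (e : ℕ → ℕ) :
    AuctionInvariant D s t σ₀ (k + 1) ((Stmt.forForCond 2 .bid bidStmt).den e σ) := by
  have hm : σ 1 0 0 = m := by rw [h.frame 1 (by omega) (by omega), h₀.card]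
  have hbase : ∀ τ : Store, (∀ y, y ≠ 13 → y ≠ 14 → τ y = σ₀ y) → HoldsDigraph D s t τ :=
    fun τ hτ => h₀.congr (hτ _ (by omega) (by omega)) (hτ _ (by omega) (by omega))
      (hτ _ (by omega) (by omega)) (hτ _ (by omega) (by omega))
  have key := Stmt.den_forForCond_induction (l := 2) (φ := .bid) (s := bidStmt) (e := e) (σ := σ)
    (fun a b τ => (∀ y, y ≠ 13 → y ≠ 14 → τ y = σ₀ y) ∧
      IsAuction (bidders D s t) (owner m τ) (price m τ) ∧
      (k + 1 ≤ ∑ c, price m τ c ∨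
        ((k ≤ ∑ c, price m τ c ∨
          ∀ a c, ¬ CanBid (bidders D s t) (owner m τ) (price m τ) a c) ∧
        ∀ a' c' : Fin m, (a'.1 < a ∨ (a'.1 = a ∧ c'.1 < b)) →
          ¬ CanBid (bidders D s t) (owner m τ) (price m τ) a' c')))
    (fun a b τ hτ => by rw [hτ.1 1 (by omega) (by omega), h₀.card, hm])
    ⟨h.frame, h.auction, Or.inr ⟨h.progress, fun a' c' h => by omega⟩⟩
    (by
      rintro a τ ⟨h1, h2, h3⟩
      refine ⟨h1, h2, h3.imp id fun h3 => ⟨h3.1, fun a' c' h => h3.2 a' c' ?_⟩⟩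
      have := c'.2
      omega)
    (by
      intro a ha b hb τ hI hφ
      obtain ⟨h1, h2, h3⟩ := hI
      rw [hm] at ha hb
      lift a to Fin m using ha
      lift b to Fin m using hb
      rw [holds_bid (hbase τ h1) (a := a) (c := b) (by simp [Function.update])
        (by simp [Function.update])] at hφ
      set τ' := bidStmt.den (Function.update (Function.update e 2 a) (2 + 1) b) τ with hτ'
      have ho : owner m τ' b = a + 1 := by
        simp [owner, hτ', bidStmt, Stmt.den, Tm.eval, Store.write, Function.update]
      have ho' : ∀ d, d ≠ b → owner m τ' d = owner m τ d := fun d hd => by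
        simp [owner, hτ', bidStmt, Stmt.den, Tm.eval, Store.write, Function.update, Fin.ext_iff]
          at hd ⊢
        omega
      have hp : price m τ' b = price m τ b + 1 := by
        simp [price, hτ', bidStmt, Stmt.den, Tm.eval, Store.write, Function.update]
      have hp' : ∀ d, d ≠ b → price m τ' d = price m τ d := fun d hd => by
        simp [price, hτ', bidStmt, Stmt.den, Tm.eval, Store.write, Function.update, Fin.ext_iff]
          at hd ⊢
        omega
      have hsum : ∑ c, price m τ' c = ∑ c, price m τ c + 1 := by
        have : ∀ c, price m τ' c = price m τ c + if c = b then 1 else 0 := fun c => by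
          by_cases hc : c = b
          · rw [hc, hp, if_pos rfl]
          · rw [hp' c hc, if_neg hc, add_zero]
        simp [this, Finset.sum_add_distrib]
      refine ⟨fun y hy hy' => ?_, h2.bid hφ ho ho' hp hp', Or.inl ?_⟩
      · rw [← h1 y hy hy', hτ', bidStmt, Stmt.den, Stmt.den, Store.write_of_ne hy,
          Stmt.den, Store.write_of_ne hy']
      · rw [hsum]
        rcases h3 with h3 | ⟨h3 | h3, -⟩
        · omega
        · omega
        · exact absurd hφ (h3 a b))
    (by
      intro a ha b hb τ hI hφ
      obtain ⟨h1, h2, h3⟩ := hI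
      rw [hm] at ha hb
      lift a to Fin m using ha
      lift b to Fin m using hb
      rw [holds_bid (hbase τ h1) (a := a) (c := b) (by simp [Function.update])
        (by simp [Function.update])] at hφ
      refine ⟨h1, h2, h3.imp id fun h3 => ⟨h3.1, fun a' c' h => ?_⟩⟩
      by_cases hab : a' = a ∧ c' = b
      · obtain ⟨rfl, rfl⟩ := hab
        exact hφ
      · refine h3.2 a' c' ?_
        simp only [Fin.ext_iff] at hab
        omega)
  obtain ⟨h1, h2, h3⟩ := key
  refine ⟨h1, h2, h3.imp id fun h3 a c => h3.2 a c (Or.inl ?_)⟩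
  rw [hm]
  exact a.2

/-- Correctness of the auction. -/
theorem den_auctionStmt (h₀ : HoldsDigraph D s t σ) (hz : ∀ x i j, 13 ≤ x → σ x i j = 0)
    (e : ℕ → ℕ) :
    (∀ y, y ≠ 13 → y ≠ 14 → auctionStmt.den e σ y = σ y) ∧
    IsAuction (bidders D s t) (owner m (auctionStmt.den e σ)) (price m (auctionStmt.den e σ)) ∧
    ∀ a c, ¬ CanBid (bidders D s t) (owner m (auctionStmt.den e σ))
      (price m (auctionStmt.den e σ)) a c := by
  have hinv : AuctionInvariant D s t σ (m * m) (auctionStmt.den e σ) := by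
    -- The two outer loops only count: together they perform `m * m` sweeps.
    have := Stmt.den_loop_induction (k := 0) (s := .loop 1 (.forForCond 2 .bid bidStmt)) (e := e)
      (σ := σ) (fun k τ => AuctionInvariant D s t σ (k * m) τ) (by
        refine ⟨fun _ _ _ => rfl, ?_, Or.inl (by omega)⟩
        have ho : ∀ c, owner m σ c = 0 := fun c => hz _ _ _ (by omega)
        have hp : ∀ c, price m σ c = 0 := fun c => hz _ _ _ (by omega)
        constructor <;> simp [ho, hp])
      (by
        intro k _ τ h
        have hm : τ 1 0 0 = m := by rw [h.frame 1 (by omega) (by omega), h₀.card]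
        have := Stmt.den_loop_induction (k := 1) (s := .forForCond 2 .bid bidStmt)
          (e := Function.update e 0 k) (σ := τ)
          (fun j τ => AuctionInvariant D s t σ (k * m + j) τ) h
          (fun j _ τ' h' => AuctionInvariant.step h₀ h' _)
        rw [hm] at this
        rwa [Nat.succ_mul])
    rw [h₀.card] at this
    exact this
  refine ⟨hinv.frame, hinv.auction, hinv.progress.elim (fun h a c hb => ?_) id⟩
  -- Prices are at most `m`, and the target of a possible bid costs less than `m`. So the sum would
  -- be below `m * m`, the number of sweeps.
  have : ∑ c, price m (auctionStmt.den e σ) c < ∑ _c : Fin m, m :=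
    Finset.sum_lt_sum (fun c _ => hinv.auction.bound c) ⟨c, Finset.mem_univ c, hb.2.2.1⟩
  simp at this
  omega

/-- Correctness of the algorithm. -/
theorem den_minLeavesStmt {n : ℕ} {P : Profile (Fin m) (Fin n)} [Nonempty (Fin n)] (hm : 3 ≤ m)
    (hP : P.trees.Nonempty) (h₀ : HoldsInput P σ) (hz : ∀ x i j, 3 ≤ x → σ x i j = 0)
    (e : ℕ → ℕ) :
    ∃ (D : Digraph (Fin m)) (s t : Fin m) (M : (matchingGraph D s t).Subgraph)
      (f : {a : Fin m // a ≠ t} → Fin m),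
      IsRun P D s t M f ∧ HoldsRun (minLeavesStmt.den e σ) D s t M f := by
  have hne : Nonempty (Fin m) := ⟨⟨0, by omega⟩⟩
  obtain ⟨T, hT⟩ := hP
  obtain ⟨D, hD, hD₁, f₁⟩ := den_digraphStmt hT.1.isAcyclic
    (hT.2.locallySinglePeaked hT.1.connected) h₀ hz e
  set σ₁ := digraphStmt.den e σ
  have hc₁ : σ₁ 1 0 0 = m := by rw [f₁ 1 (by omega) (by omega) (by omega), h₀.card]
  have hz₁ : ∀ y i j, y ≠ 3 → y ≠ 9 → y ≠ 10 → 3 ≤ y → σ₁ y i j = 0 := fun y i j h h' h'' h3 => by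
    rw [f₁ y h h' h'', hz _ _ _ h3]
  obtain ⟨f₂, ht⟩ := Stmt.den_choose (l := 0) (x := 5) (φ := .sink) (by omega) (by rfl) e σ₁
  set σ₂ := (Stmt.choose 0 5 .sink).den e σ₁
  -- The formula does not mention variable `0`, so every row receives a sink, and row `0` serves as
  -- the scalar `5`. The same device yields `s`.
  obtain ⟨t, ht, ht₂⟩ : ∃ t : Fin m, (∀ b, ¬ D.Adj t b) ∧ σ₂ 5 0 0 = t := by
    have hsink : ∀ c : Fin m, Form.sink.Holds
        (Function.update (Function.update e 0 0) (0 + 1) c) σ₁ ↔ ∀ b, ¬ D.Adj c b := by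
      intro c
      simp only [Form.sink, Form.Holds, Form.rel, Tm.eval, hc₁, forall_lt_iff_fin]
      simp [Function.update, hD₁.eq_one_iff]
    have := ht 0 (by omega)
    simp only [hc₁, exists_lt_iff_fin, hsink] at this
    obtain ⟨t, ht⟩ := Profile.Builds.exists_sink hD
    exact this ⟨t, ht⟩
  have hc₂ : σ₂ 1 0 0 = m := by rw [f₂ 1 (by omega), hc₁]
  have hD₂ : HoldsRelation σ₂ 3 D.Adj := by
    intro a b
    rw [f₂ 3 (by omega)]
    exact hD₁ a b
  obtain ⟨f₃, hs⟩ := Stmt.den_choose (l := 0) (x := 4) (φ := .source) (by omega) (by rfl) e σ₂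
  set σ₃ := (Stmt.choose 0 4 .source).den e σ₂
  obtain ⟨s, hs, hs₃⟩ : ∃ s : Fin m, (∀ b, D.Adj s b ↔ b = t) ∧ σ₃ 4 0 0 = s := by
    have hsource : ∀ c : Fin m, Form.source.Holds
        (Function.update (Function.update e 0 0) (0 + 1) c) σ₂ ↔ ∀ b, D.Adj c b ↔ b = t := by
      intro c
      simp only [Form.source, Form.Holds, Form.holds_imp, Form.rel, Form.isSink, Tm.eval, hc₂,
        ht₂, forall_lt_iff_fin]
      simp [Function.update, hD₂.eq_one_iff, iff_def, Fin.ext_iff]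
    have := hs 0 (by omega)
    simp only [hc₂, exists_lt_iff_fin, hsource] at this
    obtain ⟨s, hs⟩ := Profile.Builds.exists_source hD trivial ht (by simp [Set.ncard_univ]; omega)
    exact this ⟨s, hs⟩
  have hdig₃ : HoldsDigraph D s t σ₃ := by
    refine ⟨by rw [f₃ 1 (by omega), hc₂], fun a b => ?_, hs₃, by rw [f₃ 5 (by omega), ht₂]⟩
    rw [f₃ 3 (by omega)]
    exact hD₂ a b
  have hz₃ : ∀ y i j, y ≠ 3 → y ≠ 4 → y ≠ 5 → y ≠ 9 → y ≠ 10 → 3 ≤ y → σ₃ y i j = 0 :=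
    fun y i j h3 h4 h5 h9 h10 h => by rw [f₃ y h4, f₂ y h5, hz₁ y i j h3 h9 h10 h]
  obtain ⟨f₄, hA, hstuck⟩ := den_auctionStmt hdig₃ (fun y i j hy =>
    hz₃ y i j (by omega) (by omega) (by omega) (by omega) (by omega) (by omega)) e
  set σ₄ := auctionStmt.den e σ₃
  have hdig₄ : HoldsDigraph D s t σ₄ := hdig₃.congr (f₄ _ (by omega) (by omega))
    (f₄ _ (by omega) (by omega)) (f₄ _ (by omega) (by omega)) (f₄ _ (by omega) (by omega))
  have hM := hA.isMaximumMatching hstuck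
  set M := matchingOf (D := D) (s := s) (t := t) (R := fun a c => owner m σ₄ c = a.1 + 1)
    fun a c hac => (hA.edge a.1 c hac).1 with hMdef
  have hMadj : ∀ a c, M.Adj (Sum.inl a) (Sum.inr c) ↔ owner m σ₄ c = a.1 + 1 :=
    fun a c => matchingOf_adj _
  have hown : ∀ a c : Fin m, (∃ ha : a ≠ s ∧ a ≠ t, M.Adj (Sum.inl ⟨a, ha⟩) (Sum.inr c)) ↔
      owner m σ₄ c = a + 1 := fun a c => by
    refine ⟨fun ⟨ha, h⟩ => (hMadj _ _).1 h, fun h => ?_⟩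
    exact ⟨(hA.edge a c h).2, (hMadj _ _).2 h⟩
  have hM₅ := holdsRelation_addRel (σ := σ₄) (e := e) (x := 6) (φ := .owns 0 1)
    (R := fun a c => ∃ ha : a ≠ s ∧ a ≠ t, M.Adj (Sum.inl ⟨a, ha⟩) (Sum.inr c))
    (by omega) (by rfl) hdig₄.card (fun i j => by
      rw [f₄ 6 (by omega) (by omega), hz₃ 6 i j (by omega) (by omega) (by omega) (by omega)
        (by omega) (by omega)])
    (fun a c => by
      rw [hown]
      simp [Form.owns, Form.Holds, Tm.eval, Function.update, owner])
  have f₅ : ∀ y, y ≠ 6 → (Stmt.addRel 0 6 (.owns 0 1)).den e σ₄ y = σ₄ y := fun y hy =>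
    Stmt.den_addRel_of_ne (by omega) (by rfl) e σ₄ hy
  set σ₅ := (Stmt.addRel 0 6 (.owns 0 1)).den e σ₄
  have hdig₅ : HoldsDigraph D s t σ₅ := hdig₄.congr (f₅ _ (by omega)) (f₅ _ (by omega))
    (f₅ _ (by omega)) (f₅ _ (by omega))
  obtain ⟨f₆, hf⟩ := Stmt.den_choose (l := 0) (x := 7) (φ := .value) (by omega) (by rfl) e σ₅
  set σ₆ := (Stmt.choose 0 7 .value).den e σ₅
  have hM₅' : ∀ a c : Fin m, σ₅ 6 a c = 1 ↔ owner m σ₄ c = a + 1 := fun a c =>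
    (hM₅.eq_one_iff a c).trans (hown a c)
  have hvalue : ∀ a c : Fin m, Form.value.Holds
      (Function.update (Function.update e 0 a) (0 + 1) c) σ₅ ↔
        a ≠ t ∧ D.Adj a c ∧ (owner m σ₄ c = a + 1 ∨ ∀ d, owner m σ₄ d ≠ a + 1) := by
    intro a c
    simp only [Form.value, Form.Holds, Form.holds_or, Form.rel, Form.isSink, Tm.eval, hdig₅.card,
      hdig₅.sink, forall_lt_iff_fin]
    simp only [Function.update_self, ne_eq, zero_add, zero_ne_one, not_false_eq_true,
      Function.update_of_ne, OfNat.zero_ne_ofNat, hdig₅.digraph.eq_one_iff,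
      hM₅', Fin.ext_iff]
  -- The vertex `s` owns nothing and is treated like an unmatched vertex; its only arc then forces
  -- `f(s) = t`.
  have hex : ∀ a : {a : Fin m // a ≠ t}, ∃ c : Fin m, (D.Adj a.1 c ∧
      (owner m σ₄ c = a.1 + 1 ∨ ∀ d, owner m σ₄ d ≠ a.1 + 1)) ∧ σ₆ 7 a.1 0 = c := by
    rintro ⟨a, hat⟩
    have := hf a (hdig₅.card ▸ a.2)
    simp only [hdig₅.card, exists_lt_iff_fin, hvalue] at this
    obtain ⟨c, ⟨-, h⟩, h'⟩ := this (by
      by_cases hmat : ∃ c, owner m σ₄ c = a + 1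
      · obtain ⟨c, hc⟩ := hmat
        exact ⟨c, hat, (hA.edge a c hc).1, Or.inl hc⟩
      · obtain ⟨c, hc⟩ := Profile.Builds.exists_adj hD ht hat
        exact ⟨c, hat, hc, Or.inr fun d hd => hmat ⟨d, hd⟩⟩)
    exact ⟨c, h, h'⟩
  choose f hfD hf₆ using hex
  have hdig₆ : HoldsDigraph D s t σ₆ := hdig₅.congr (f₆ _ (by omega)) (f₆ _ (by omega))
    (f₆ _ (by omega)) (f₆ _ (by omega))
  have hT₇ := holdsRelation_addRel (σ := σ₆) (e := e) (x := 8) (φ := .treeAdj)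
    (R := (attachmentTree f).Adj) (by omega) (by rfl) hdig₆.card (fun i j => by
      rw [f₆ 8 (by omega), f₅ 8 (by omega), f₄ 8 (by omega) (by omega), hz₃ 8 i j (by omega)
        (by omega) (by omega) (by omega) (by omega) (by omega)])
    (fun a b => by
      have hval : ∀ a b : Fin m, (a ≠ t ∧ σ₆ 7 a 0 = b) ↔ ∃ h : a ≠ t, f ⟨a, h⟩ = b :=
        fun a b => ⟨fun h => ⟨h.1, Fin.ext ((hf₆ ⟨a, h.1⟩).symm.trans h.2)⟩,
          fun ⟨h, h'⟩ => ⟨h, (hf₆ ⟨a, h⟩).trans (congrArg Fin.val h')⟩⟩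
      rw [attachmentTree_adj, ← hval, ← hval]
      simp only [Form.treeAdj, Form.Holds, Form.holds_or, Form.same, Form.isSink, Tm.eval,
        hdig₆.sink]
      simp [Function.update, Fin.ext_iff])
  have f₇ : ∀ y, y ≠ 8 → (Stmt.addRel 0 8 .treeAdj).den e σ₆ y = σ₆ y := fun y hy =>
    Stmt.den_addRel_of_ne (by omega) (by rfl) e σ₆ hy
  have hden : minLeavesStmt.den e σ = (Stmt.addRel 0 8 .treeAdj).den e σ₆ := rfl
  rw [hden]
  set σ₇ := (Stmt.addRel 0 8 .treeAdj).den e σ₆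
  have hdig₇ : HoldsDigraph D s t σ₇ := hdig₆.congr (f₇ _ (by omega)) (f₇ _ (by omega))
    (f₇ _ (by omega)) (f₇ _ (by omega))
  refine ⟨D, s, t, M, f, ⟨hD, ht, hs, hM, fun h => ?_, fun a ha c h => ?_, fun a ha _ => ?_⟩,
    ⟨hdig₇.digraph, hdig₇.source, hdig₇.sink, ?_, fun a => ?_, hT₇⟩⟩
  · exact (hs _).1 (hfD ⟨s, h⟩).1
  · have hc := (hMadj _ _).1 h
    rcases (hfD ⟨a, ha.2⟩).2 with h' | h'
    · exact hA.inj _ _ (h'.trans hc.symm) (by rw [h']; omega)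
    · exact absurd hc (h' c)
  · exact (hfD ⟨a, ha.2⟩).1
  · intro a c
    rw [f₇ 6 (by omega), f₆ 6 (by omega)]
    exact hM₅ a c
  · rw [f₇ 7 (by omega), hf₆]

end Semantics

end RAM

/-! ### The main theorem -/

theorem mainTheorem8 :
    -- every run of the algorithm returns an optimal tree
    (∀ (C : Type u) (N : Type v) [Finite C] [Finite N] [Nonempty N] (P : Profile C N),
      3 ≤ Nat.card C → P.trees.Nonempty →
        (∃ D : Digraph C, P.IsAttachmentDigraph D) ∧
        (∀ D : Digraph C, P.IsAttachmentDigraph D →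
          ∃ (s t : C) (M : (matchingGraph D s t).Subgraph) (f : {a : C // a ≠ t} → C),
            IsRun P D s t M f) ∧
        ∀ (D : Digraph C) (s t : C) (M : (matchingGraph D s t).Subgraph)
          (f : {a : C // a ≠ t} → C), IsRun P D s t M f →
            attachmentTree f ∈ P.trees ∧
            (∀ T ∈ P.trees, (leaves (attachmentTree f)).ncard ≤ (leaves T).ncard) ∧
            (internalVertices (attachmentTree f)).ncard = M.edgeSet.ncard) ∧
    -- the algorithm can be carried out in polynomial time
    (∃ (p : RAM.Program) (q : Polynomial ℕ), ∀ (m n : ℕ) (P : Profile (Fin m) (Fin n)),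
      3 ≤ m → 1 ≤ n → P.trees.Nonempty →
        ∃ (k : ℕ) (τ : RAM.Store), RAM.Runs p (RAM.inputStore P) k τ ∧ k ≤ q.eval (m * n) ∧
          ∃ (D : Digraph (Fin m)) (s t : Fin m) (M : (matchingGraph D s t).Subgraph)
            (f : {a : Fin m // a ≠ t} → Fin m),
            IsRun P D s t M f ∧ RAM.HoldsRun τ D s t M f) := by
  refine ⟨fun C N _ _ _ P hC ⟨T, hT⟩ => ⟨?_, fun D hD => exists_isRun hC hD,
    fun D s t M f h => ⟨h.attachmentTree_mem_trees, fun T hT => h.ncard_leaves_le hT,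
      h.ncard_internalVertices⟩⟩, ?_⟩
  · exact (hT.2.locallySinglePeaked hT.1.connected).exists_builds hT.1.isAcyclic
  · obtain ⟨q, hq⟩ := RAM.minLeavesStmt.exists_runs_prog 0 (by rfl)
    refine ⟨RAM.minLeavesStmt.prog 0, q, fun m n P hm hn hP => ?_⟩
    have : Nonempty (Fin n) := ⟨⟨0, hn⟩⟩
    have hinp : RAM.HoldsInput P (RAM.inputStore P) := by
      refine ⟨fun i a => ?_, ?_, ?_⟩ <;> simp [RAM.inputStore]
    -- As `m` and `n` are positive, `m * n` bounds both sizes. The input memory represents itself,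
    -- since no variable is in use at level `0`.
    obtain ⟨k, τ, hr, hk, hag⟩ := hq (m * n) (fun _ => 0) (RAM.inputStore P) (RAM.inputStore P)
      (by rw [hinp.card]; exact Nat.le_mul_of_pos_right m hn)
      (by rw [hinp.voters]; exact Nat.le_mul_of_pos_left n (by omega))
      ⟨fun _ _ => rfl, fun k hk => absurd hk (Nat.not_lt_zero k)⟩
    obtain ⟨D, s, t, M, f, hrun, hold⟩ := RAM.den_minLeavesStmt hm hP hinp (fun x i j hx => by
      simp only [RAM.inputStore]
      rw [if_neg (by omega), if_neg (by omega), if_neg (by omega)]) fun _ => 0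
    refine ⟨k, τ, hr, hk, D, s, t, M, f, hrun, ?_⟩
    refine ⟨?_, ?_, ?_, ?_, ?_, ?_⟩ <;> simp only [RAM.HoldsRelation,
      hag.store 3 (by omega), hag.store 4 (by omega), hag.store 5 (by omega),
      hag.store 6 (by omega), hag.store 7 (by omega), hag.store 8 (by omega)]
    exacts [hold.digraph, hold.source, hold.sink, hold.matching, hold.values, hold.tree]
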